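/- For $r>0$ let $\mathbb{T}_{2\pi r^{-1}}=\mathbb{R}/(2\pi r^{-1}\mathbb{Z})$ with its normalized Haar measure, let $c_x(k)=e^{ixk}$ for $x\in r\mathbb{Z}$, and let $\mathcal{F}_r\colon L^2(\mathbb{T}_{2\pi r^{-1}})\to\ell_2(r\mathbb{Z})$ be the Fourier transform, i.e. the unitary operator with $\mathcal{F}_r c_x=\delta_x$. Let $D_r$ be the self-adjoint diagonal operator $D_r\delta_x=x\delta_x$ on $\ell_2(r\mathbb{Z})$, and let $M[g]$ denote multiplication by $g$ on $L^2(\mathbb{T}_{2\pi r^{-1}})$. Write $\mathbb{T}=\{z\in\mathbb{C} : |z|=1\}$. An analytic map $\lambda\colon\mathbb{T}_{2\pi r^{-1}}\to\mathbb{T}$ defines the model quantum walk $(\ell_2(r\mathbb{Z}),(U_\lambda^t)_{t\in\mathbb{Z}},D_r)$ with $U_\lambda=\mathcal{F}_rM[\lambda]\mathcal{F}_r^{-1}$. The walk is called prime if $\lambda$ has no period, that is, if no $p\neq 0$ in $\mathbb{T}_{2\pi r^{-1}}$ satisfies $\lambda(k+p)=\lambda(k)$ for all $k$. Let $r(1),r(2)>0$,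 let $l(\iota)=2\pi r(\iota)^{-1}$, and let $\lambda_\iota\colon\mathbb{T}_{l(\iota)}\to\mathbb{T}$ ($\iota=1,2$) be analytic maps without period, with prime model quantum walks $(\ell_2(r(\iota)\mathbb{Z}),(U_\iota^t)_{t\in\mathbb{Z}},D_{r(\iota)})$, where $U_\iota=U_{\lambda_\iota}$. A uniform intertwiner between the two walks is a bounded operator $V\colon\ell_2(r(1)\mathbb{Z})\to\ell_2(r(2)\mathbb{Z})$ such that $VU_1=U_2V$ and such that $\mathbb{R}\ni k\mapsto e^{ikD_{r(2)}}Ve^{-ikD_{r(1)}}$ is continuous in the operator norm. Assume that there exists a nonzero uniform intertwiner between the two walks. Then $r(1)=r(2)=:r$, hence $l(1)=l(2)=:l$, and there exists a unique $\alpha\in\mathbb{T}_l$ such that $$\lambda_2(k)=\lambda_1(k+\alpha),\qquad k\in\mathbb{T}_l.$$ Moreover, the set of all uniform intertwiners between the two walks is equal to $$\left\{\mathcal{F}_rM[\rho]\mathcal{F}_r^{-1}\exp(i\alpha D_r)\ \middle|\ \rho\colon\mathbb{T}_l\to\mathbb{C}\ \text{continuous}\right\},$$ where $\exp(i\alpha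 D_r)$ is the diagonal operator $\delta_x\mapsto e^{i\alpha x}\delta_x$, which does not depend on the choice of a real representative of $\alpha$. -/

import Mathlib

namespace ModelWalk

noncomputable section

open Complex MeasureTheory Filter Topology
open scoped ENNReal

/-! ### The lattice `rℤ`, its dual torus and the Fourier transform -/

/-- The lattice `rℤ ⊂ ℝ`. -/
abbrev Lattice (r : ℝ) : Type := AddSubgroup.zmultiples r

/-- The dual group of `rℤ`: the torus `ℝ / (2π r⁻¹ ℤ)` of length `2π r⁻¹`. -/
abbrev Torus (r : ℝ) : Type := AddCircle (2 * Real.pi * r⁻¹)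

instance fact_length_pos {r : ℝ} [hr : Fact (0 < r)] : Fact (0 < 2 * Real.pi * r⁻¹) :=
  ⟨mul_pos Real.two_pi_pos (inv_pos.2 hr.out)⟩

/-- The Hilbert space `ℓ₂(rℤ)`. -/
abbrev EllTwo (r : ℝ) : Type := lp (fun _ : Lattice r => ℂ) 2

/-- The Hilbert space `L²` of the torus, for the Haar measure `(r / 2π) dk` of total mass one. -/
abbrev LTwo (r : ℝ) [Fact (0 < r)] : Type :=
  Lp ℂ 2 (AddCircle.haarAddCircle : Measure (Torus r))

lemma exp_periodic {r : ℝ} [hr : Fact (0 < r)] (x : Lattice r) :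
    Function.Periodic (fun k : ℝ => cexp (I * (x : ℝ) * k)) (2 * Real.pi * r⁻¹) := by
  obtain ⟨x, n, rfl⟩ := x
  intro k
  have hr0 : (r : ℂ) ≠ 0 := by exact_mod_cast hr.out.ne'
  refine Complex.exp_eq_exp_iff_exists_int.2 ⟨n, ?_⟩
  push_cast [zsmul_eq_mul]
  field_simp

/-- The character `c_x(k) = exp(i x k)` of the torus, for `x ∈ rℤ`. -/
def character (r : ℝ) [Fact (0 < r)] (x : Lattice r) : C(Torus r, ℂ) where
  toFun := (exp_periodic x).lift
  continuous_toFun := continuous_coinduced_dom.2 (by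
    change Continuous fun k : ℝ => cexp (I * (x : ℝ) * k)
    fun_prop)

@[simp] lemma character_coe (r : ℝ) [Fact (0 < r)] (x : Lattice r) (k : ℝ) :
    character r x (k : Torus r) = cexp (I * (x : ℝ) * k) := rfl

lemma character_zsmul (r : ℝ) [hr : Fact (0 < r)] (n : ℤ) :
    character r ⟨n • r, n, rfl⟩ = fourier n := by
  ext k
  induction k using QuotientAddGroup.induction_on with
  | H k =>
    have hr0 : (r : ℂ) ≠ 0 := by exact_mod_cast hr.out.ne'
    refine (character_coe r _ k).trans (Eq.trans ?_ (fourier_coe_apply (n := n) (x := k)).symm)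
    congr 1
    push_cast [zsmul_eq_mul]
    field_simp

/-- The character `c_x` as a vector of `L²`. -/
def characterLp (r : ℝ) [Fact (0 < r)] (x : Lattice r) : LTwo r :=
  ContinuousMap.toLp 2 AddCircle.haarAddCircle ℂ (character r x)

lemma characterLp_zsmul (r : ℝ) [Fact (0 < r)] (n : ℤ) :
    characterLp r ⟨n • r, n, rfl⟩ = fourierLp 2 n := by
  rw [characterLp, character_zsmul]

lemma orthonormal_characterLp (r : ℝ) [hr : Fact (0 < r)] : Orthonormal ℂ (characterLp r) := by
  have h := orthonormal_fourier (T := 2 * Real.pi * r⁻¹)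
  refine ⟨?_, ?_⟩
  · rintro ⟨x, n, rfl⟩
    rw [show characterLp r ⟨(fun n : ℤ => n • r) n, n, rfl⟩ = _ from characterLp_zsmul r n]
    exact h.1 n
  · rintro ⟨x, n, rfl⟩ ⟨y, m, rfl⟩ hnm
    rw [show characterLp r ⟨(fun n : ℤ => n • r) n, n, rfl⟩ = _ from characterLp_zsmul r n,
      show characterLp r ⟨(fun n : ℤ => n • r) m, m, rfl⟩ = _ from characterLp_zsmul r m]
    exact h.2 (fun e => hnm (by subst e; rfl))

lemma span_characterLp (r : ℝ) [Fact (0 < r)] :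
    ⊤ ≤ (Submodule.span ℂ (Set.range (characterLp r))).topologicalClosure := by
  rw [← span_fourierLp_closure_eq_top (T := 2 * Real.pi * r⁻¹) (p := 2) (by simp)]
  refine Submodule.topologicalClosure_mono (Submodule.span_mono ?_)
  rintro _ ⟨n, rfl⟩
  exact ⟨_, characterLp_zsmul r n⟩

/-- The Fourier transform `F_r : L²(ℝ / 2π r⁻¹ ℤ) → ℓ₂(rℤ)`, the unitary operator with
`F_r c_x = δ_x`. -/
def fourierTransform (r : ℝ) [Fact (0 < r)] : LTwo r ≃ₗᵢ[ℂ] EllTwo r :=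
  (HilbertBasis.mk (orthonormal_characterLp r) (span_characterLp r)).repr

open Classical in
lemma fourierTransform_characterLp (r : ℝ) [Fact (0 < r)] (x : Lattice r) :
    fourierTransform r (characterLp r x) = lp.single 2 x (1 : ℂ) := by
  have h := (HilbertBasis.mk (orthonormal_characterLp r) (span_characterLp r)).repr_self x
  rwa [HilbertBasis.coe_mk] at h

/-! ### The position operator and its unitary group -/

/-- The self-adjoint diagonal operator `D_r`, `D_r δ_x = x δ_x`, on its maximal domain
`{ξ ∈ ℓ₂(rℤ) | (x ξ(x))_x ∈ ℓ₂(rℤ)}`. -/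
def position (r : ℝ) : EllTwo r →ₗ.[ℂ] EllTwo r where
  domain :=
    { carrier := {ξ | Memℓp (fun x : Lattice r => ((x : ℝ) : ℂ) * ξ x) 2}
      add_mem' := fun {a b} ha hb => by
        have h := Memℓp.add ha hb
        refine (congrArg (fun f => Memℓp f 2) ?_).mp h
        ext x
        simp [mul_add]
      zero_mem' := by
        refine (congrArg (fun f => Memℓp f 2) ?_).mp
          (zero_memℓp (E := fun _ : Lattice r => ℂ) (p := 2))
        ext x
        simp
      smul_mem' := fun c a ha => by
        have h := Memℓp.const_smul ha c
        refine (congrArg (fun f => Memℓp f 2) ?_).mp h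
        ext x
        simp [mul_left_comm] }
  toFun :=
    { toFun := fun ξ => ⟨fun x : Lattice r => ((x : ℝ) : ℂ) * ξ.1 x, ξ.2⟩
      map_add' := fun a b => by
        ext x
        exact mul_add _ _ _
      map_smul' := fun c a => by
        ext x
        simp [mul_left_comm] }

/-- The unitary operator `exp(i k D_r)` on `ℓ₂(rℤ)`: as `D_r` is diagonal, it is the diagonal
operator `δ_x ↦ exp(i k x) δ_x`. See `hasDerivAt_expPosition` for its relation to `D_r`. -/
def expPosition (r : ℝ) (k : ℝ) : EllTwo r →L[ℂ] EllTwo r :=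
  lp.mapCLM 2 (fun x : Lattice r => cexp (I * k * (x : ℝ)) • ContinuousLinearMap.id ℂ ℂ)
    (K := 1) zero_le_one (fun x => by
      rw [norm_smul, show I * k * (x : ℝ) = ((k * (x : ℝ) : ℝ) : ℂ) * I by push_cast; ring,
        Complex.norm_exp_ofReal_mul_I, one_mul]
      exact ContinuousLinearMap.norm_id_le)

@[simp] lemma expPosition_apply (r k : ℝ) (ξ : EllTwo r) (x : Lattice r) :
    expPosition r k ξ x = cexp (I * k * (x : ℝ)) * ξ x := by
  simp [expPosition]

/-- `k ↦ exp(i k D_r)` solves `d/dk exp(i k D_r) ξ = exp(i k D_r) (i D_r ξ)` on the domain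
of `D_r`. -/
lemma hasDerivAt_expPosition (r k : ℝ) (ξ : (position r).domain) :
    HasDerivAt (fun t : ℝ => expPosition r t (ξ : EllTwo r))
      (expPosition r k (I • position r ξ)) k := by
  rw [hasDerivAt_iff_tendsto_slope, tendsto_iff_norm_sub_tendsto_zero]
  set η : EllTwo r := position r ξ with hη
  have hηx : ∀ x : Lattice r, η x = ((x : ℝ) : ℂ) * (ξ : EllTwo r) x := fun x => rfl
  set e : Lattice r → ℝ → ℂ := fun x t => cexp (I * t * (x : ℝ)) with he
  set q : ℝ → Lattice r → ℂ := fun t x =>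
    slope (e x) k t * (ξ : EllTwo r) x - e x k * (I * η x) with hq
  have hde : ∀ (x : Lattice r) (t : ℝ), HasDerivAt (e x) (e x t * (I * (x : ℝ))) t := by
    intro x t
    have h : HasDerivAt (fun t : ℝ => I * (t : ℂ) * ((x : ℝ) : ℂ)) (I * (x : ℝ)) t := by
      simpa using ((hasDerivAt_id t).ofReal_comp.const_mul I).mul_const ((x : ℝ) : ℂ)
    exact h.cexp
  have hnorm : ∀ (x : Lattice r) (t : ℝ), ‖e x t‖ = 1 := by
    intro x t
    simp only [he]
    rw [show I * t * (x : ℝ) = ((t * (x : ℝ) : ℝ) : ℂ) * I by push_cast; ring,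
      Complex.norm_exp_ofReal_mul_I]
  have hcoord : ∀ (t : ℝ) (x : Lattice r),
      (slope (fun t : ℝ => expPosition r t (ξ : EllTwo r)) k t
        - expPosition r k (I • η)) x = q t x := by
    intro t x
    simp only [slope, vsub_eq_sub, lp.coeFn_sub, lp.coeFn_smul, Pi.sub_apply, Pi.smul_apply,
      expPosition_apply, hq, he, smul_eq_mul, Complex.real_smul]
    ring
  have hslope : ∀ (x : Lattice r) (t : ℝ), ‖slope (e x) k t‖ ≤ |(x : ℝ)| := by
    intro x t
    have h := Convex.norm_image_sub_le_of_norm_hasDerivWithin_le (f := e x)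
      (f' := fun t => e x t * (I * (x : ℝ))) (s := Set.univ) (C := |(x : ℝ)|) (x := k) (y := t)
      (fun u _ => (hde x u).hasDerivWithinAt)
      (fun u _ => by simp [hnorm]) convex_univ (Set.mem_univ _) (Set.mem_univ _)
    rw [slope, vsub_eq_sub, norm_smul, norm_inv]
    rcases eq_or_ne t k with rfl | hne
    · simp
    · rw [inv_mul_le_iff₀ (norm_pos_iff.2 (sub_ne_zero.2 hne)), mul_comm]
      exact h
  have hbound : ∀ (t : ℝ) (x : Lattice r), ‖q t x‖ ≤ 2 * ‖η x‖ := by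
    intro t x
    have h1 : ‖slope (e x) k t * (ξ : EllTwo r) x‖ ≤ ‖η x‖ := by
      rw [norm_mul, hηx, norm_mul, Complex.norm_real, Real.norm_eq_abs]
      exact mul_le_mul_of_nonneg_right (hslope x t) (norm_nonneg _)
    have h2 : ‖e x k * (I * η x)‖ = ‖η x‖ := by simp [hnorm]
    calc ‖q t x‖ ≤ _ := norm_sub_le _ _
      _ ≤ 2 * ‖η x‖ := by rw [h2]; linarith
  have hsum : Summable fun x : Lattice r => (2 * ‖η x‖) ^ 2 := by
    have h := (lp.memℓp η).summable (by norm_num)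
    simp only [mul_pow]
    refine Summable.mul_left _ ?_
    simpa using h
  have hlim : ∀ x : Lattice r, Tendsto (fun t => ‖q t x‖ ^ 2) (𝓝[≠] k) (𝓝 0) := by
    intro x
    have h := hasDerivAt_iff_tendsto_slope.1 (hde x k)
    have h2 : Tendsto (fun t => q t x) (𝓝[≠] k) (𝓝 0) := by
      have h3 := (h.mul_const ((ξ : EllTwo r) x)).sub_const (e x k * (I * η x))
      have h4 : e x k * (I * ((x : ℝ) : ℂ)) * (ξ : EllTwo r) x - e x k * (I * η x) = 0 := by
        rw [hηx]
        ring
      rwa [h4] at h3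
    simpa using h2.norm.pow 2
  have htsum : Tendsto (fun t => ∑' x : Lattice r, ‖q t x‖ ^ 2) (𝓝[≠] k) (𝓝 0) := by
    have h := tendsto_tsum_of_dominated_convergence hsum hlim
      (Eventually.of_forall fun t x => by
        rw [Real.norm_eq_abs, abs_of_nonneg (by positivity)]
        exact pow_le_pow_left₀ (norm_nonneg _) (hbound t x) 2)
    simpa using h
  have hsq := htsum.sqrt
  rw [Real.sqrt_zero] at hsq
  refine hsq.congr fun t => ?_
  rw [lp.norm_eq_tsum_rpow (by norm_num), Real.sqrt_eq_rpow]
  simp only [hcoord]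
  norm_num

/-! ### Model quantum walks and uniform intertwiners -/

/-- The multiplication operator `M[g]` on `L²` of the torus, for continuous `g`. -/
def mulOp (r : ℝ) [Fact (0 < r)] (g : C(Torus r, ℂ)) : LTwo r →L[ℂ] LTwo r :=
  (ContinuousLinearMap.mul ℂ ℂ).holderL AddCircle.haarAddCircle ∞ 2 2
    (ContinuousMap.toLp ∞ AddCircle.haarAddCircle ℂ g)

lemma mulOp_ae (r : ℝ) [Fact (0 < r)] (g : C(Torus r, ℂ)) (ξ : LTwo r) :
    mulOp r g ξ =ᵐ[AddCircle.haarAddCircle] fun k => g k * ξ k := by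
  have h1 := (ContinuousLinearMap.mul ℂ ℂ).coeFn_holder (r := 2)
    (ContinuousMap.toLp ∞ AddCircle.haarAddCircle ℂ g) ξ
  have h2 := ContinuousMap.coeFn_toLp (p := ∞) (𝕜 := ℂ) AddCircle.haarAddCircle g
  filter_upwards [h1, h2] with k hk1 hk2
  refine hk1.trans ?_
  rw [hk2]
  rfl

/-- The operator `F_r M[g] F_r⁻¹` on `ℓ₂(rℤ)`. -/
def fourierMulOp (r : ℝ) [Fact (0 < r)] (g : C(Torus r, ℂ)) : EllTwo r →L[ℂ] EllTwo r :=
  ((fourierTransform r).toContinuousLinearEquiv : LTwo r →L[ℂ] EllTwo r) ∘L mulOp r g ∘L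
    ((fourierTransform r).symm.toContinuousLinearEquiv : EllTwo r →L[ℂ] LTwo r)

/-- A map from the torus to the unit circle, viewed as a complex-valued function. -/
def toComplex {r : ℝ} (lam : C(Torus r, Circle)) : C(Torus r, ℂ) where
  toFun k := (lam k : ℂ)
  continuous_toFun := continuous_subtype_val.comp lam.continuous

/-- `λ : ℝ / 2π r⁻¹ ℤ → 𝕋` is (real) analytic. -/
def IsAnalytic {r : ℝ} (lam : C(Torus r, Circle)) : Prop :=
  ∀ k : ℝ, AnalyticAt ℝ (fun t : ℝ => (lam (t : Torus r) : ℂ)) k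

/-- `λ : ℝ / 2π r⁻¹ ℤ → 𝕋` has no period other than `0`. -/
def HasNoPeriod {r : ℝ} (lam : C(Torus r, Circle)) : Prop :=
  ∀ p : Torus r, (∀ k : Torus r, lam (k + p) = lam k) → p = 0

/-- The generator `U_λ = F_r M[λ] F_r⁻¹` of the model quantum walk
`(ℓ₂(rℤ), (U_λ ^ t)_{t ∈ ℤ}, D_r)`. -/
def walk (r : ℝ) [Fact (0 < r)] (lam : C(Torus r, Circle)) : EllTwo r →L[ℂ] EllTwo r :=
  fourierMulOp r (toComplex lam)

/-- A bounded operator `V : ℓ₂(r₁ℤ) → ℓ₂(r₂ℤ)` is uniform with respect to `D_{r₁}` and `D_{r₂}` if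
`k ↦ exp(i k D_{r₂}) V exp(-i k D_{r₁})` is continuous in the operator norm. -/
def IsUniform {r₁ r₂ : ℝ} (V : EllTwo r₁ →L[ℂ] EllTwo r₂) : Prop :=
  Continuous fun k : ℝ => expPosition r₂ k ∘L V ∘L expPosition r₁ (-k)

/-- Uniform intertwiners between the model quantum walks given by `λ₁` and `λ₂`. -/
def IsUniformIntertwiner {r₁ r₂ : ℝ} [Fact (0 < r₁)] [Fact (0 < r₂)]
    (lam₁ : C(Torus r₁, Circle)) (lam₂ : C(Torus r₂, Circle))
    (V : EllTwo r₁ →L[ℂ] EllTwo r₂) : Prop :=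
  V ∘L walk r₁ lam₁ = walk r₂ lam₂ ∘L V ∧ IsUniform V

end

end ModelWalk

open ModelWalk

/-!
A bounded operator `V` with `V U₁ = U₂ V` becomes, after Fourier transform, an operator
`L²(𝕋₁) → L²(𝕋₂)` intertwining the multiplications by `λ₁` and `λ₂`. Its "kernel" therefore lives
on the real analytic set `Z = {(k, k') | λ₂ k = λ₁ k'}` (`Intertwines.suppIn`), and the kernel of
its conjugate `V(s) = exp(i s D) V exp(-i s D)` lives on the translate of `Z` along the diagonal.
Where `Z` is transversal to the diagonal direction, `Z` and its small translates are disjoint, so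
decomposing vectors into pieces living on small level sets of `λ₁` gives `‖V‖ ≤ ‖V(s) - V‖`
locally (`Intertwines.integral_le`). As the right-hand side tends to `0` with `s` by uniformity,
`V` vanishes there (`Intertwines.exists_nhds_vanishes`).

So `V` is carried by the pairs with `λ₂ k = λ₁ k'` and `λ₂' k = λ₁' k'`. If only countably many `k'`
occur in such pairs, they form a null set and `V = 0`, vanishing being a local property
(`vanishes_of_locally`). Otherwise such pairs accumulate at a noncritical one, near which the
transition function `λ₁⁻¹ ∘ λ₂` is analytic with derivative `1` on an accumulating set, hence a
shift; by the identity theorem `λ₂` is globally a shift of `λ₁` (`exists_shift_of_not_countable`,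
`Intertwines.vanishes_or_shift`). Absence of periods then forces the two tori to have the same
length (`eq_of_shift`) and the shift to be unique.

To determine all uniform intertwiners, compose with `exp(-i a D)` so as to assume `λ₁ = λ₂`. The
same dichotomy, applied from a closed set `I` to a disjoint closed set `J`, shows that the operator
is local, because a shift relating points of `I` and `J` would be a nonzero period
(`Intertwines.isLocal`). A local operator `W` is multiplication by the conjugate of `W† 1`, so it
commutes with all multiplications (`IsLocal.comm_mulOp`). Finally the Fourier coefficients of the
continuous function `s ↦ W(s)` are multiples of multiplications by characters, so `W = W(0)` lies in
the closed space of multiplications by continuous functions (`UniformOp.exists_eq_mulOp`).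
-/

namespace ModelWalk

noncomputable section

open Complex MeasureTheory Filter Topology
open scoped ENNReal

/-! ### Multiplication operators and translations -/

/-- The multiplication operator `M[g]`, as a bounded linear function of `g`. -/
def mulOpL (r : ℝ) [Fact (0 < r)] : C(Torus r, ℂ) →L[ℂ] (LTwo r →L[ℂ] LTwo r) :=
  ((ContinuousLinearMap.mul ℂ ℂ).holderL AddCircle.haarAddCircle ∞ 2 2).comp
    (ContinuousMap.toLp ∞ AddCircle.haarAddCircle ℂ)

lemma mulOpL_apply (r : ℝ) [Fact (0 < r)] (g : C(Torus r, ℂ)) : mulOpL r g = mulOp r g := rfl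

lemma continuous_mulOp (r : ℝ) [Fact (0 < r)] : Continuous (mulOp r) := (mulOpL r).continuous

lemma mulOp_mul_apply (r : ℝ) [Fact (0 < r)] (g h : C(Torus r, ℂ)) (ξ : LTwo r) :
    mulOp r (g * h) ξ = mulOp r g (mulOp r h ξ) := by
  apply Lp.ext
  filter_upwards [mulOp_ae r (g * h) ξ, mulOp_ae r g (mulOp r h ξ), mulOp_ae r h ξ]
    with k h1 h2 h3
  rw [h1, h2, h3, ContinuousMap.mul_apply, mul_assoc]

lemma mulOp_one (r : ℝ) [Fact (0 < r)] : mulOp r 1 = ContinuousLinearMap.id ℂ (LTwo r) := by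
  ext1 ξ
  apply Lp.ext
  filter_upwards [mulOp_ae r 1 ξ] with k h1
  rw [h1]
  simp

lemma mulOp_comm_apply (r : ℝ) [Fact (0 < r)] (g h : C(Torus r, ℂ)) (ξ : LTwo r) :
    mulOp r g (mulOp r h ξ) = mulOp r h (mulOp r g ξ) := by
  rw [← mulOp_mul_apply, mul_comm g h, mulOp_mul_apply]

lemma mulOp_toLp (r : ℝ) [Fact (0 < r)] (g h : C(Torus r, ℂ)) :
    mulOp r g (ContinuousMap.toLp 2 AddCircle.haarAddCircle ℂ h) =
      ContinuousMap.toLp 2 AddCircle.haarAddCircle ℂ (g * h) := by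
  apply Lp.ext
  filter_upwards [mulOp_ae r g (ContinuousMap.toLp 2 AddCircle.haarAddCircle ℂ h),
    ContinuousMap.coeFn_toLp (p := 2) (𝕜 := ℂ) AddCircle.haarAddCircle h,
    ContinuousMap.coeFn_toLp (p := 2) (𝕜 := ℂ) AddCircle.haarAddCircle (g * h)] with k h1 h2 h3
  rw [h1, h2, h3, ContinuousMap.mul_apply]

lemma character_add (r : ℝ) [Fact (0 < r)] (x y : Lattice r) :
    character r x * character r y = character r (x + y) := by
  ext k
  induction k using QuotientAddGroup.induction_on with
  | H k =>
    simp only [ContinuousMap.mul_apply, character_coe, ← Complex.exp_add]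
    congr 1
    push_cast
    ring

lemma mulOp_characterLp {r : ℝ} [Fact (0 < r)] (x y : Lattice r) :
    mulOp r (character r x) (characterLp r y) = characterLp r (x + y) := by
  rw [characterLp, mulOp_toLp, character_add]
  rfl

/-- Bounded operators agreeing on all characters are equal. -/
lemma clm_ext_characterLp {r : ℝ} [Fact (0 < r)] {E : Type*} [NormedAddCommGroup E]
    [NormedSpace ℂ E] {A B : LTwo r →L[ℂ] E}
    (h : ∀ x, A (characterLp r x) = B (characterLp r x)) : A = B := by
  refine ContinuousLinearMap.ext_on (s := Set.range (characterLp r)) ?_ ?_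
  · rw [Submodule.dense_iff_topologicalClosure_eq_top]
    exact top_le_iff.1 (span_characterLp r)
  · rintro _ ⟨x, rfl⟩
    exact h x

lemma span_character_closure (r : ℝ) [Fact (0 < r)] :
    (Submodule.span ℂ (Set.range (character r))).topologicalClosure = ⊤ := by
  rw [← top_le_iff, ← span_fourier_closure_eq_top (T := 2 * Real.pi * r⁻¹)]
  refine Submodule.topologicalClosure_mono (Submodule.span_mono ?_)
  rintro _ ⟨n, rfl⟩
  exact ⟨_, character_zsmul r n⟩

/-- Bounded operators on `C(𝕋)` agreeing on all characters are equal. -/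
lemma clm_ext_character {r : ℝ} [Fact (0 < r)] {E : Type*} [NormedAddCommGroup E]
    [NormedSpace ℂ E] {A B : C(Torus r, ℂ) →L[ℂ] E}
    (h : ∀ x, A (character r x) = B (character r x)) : A = B := by
  refine ContinuousLinearMap.ext_on (s := Set.range (character r)) ?_ ?_
  · rw [Submodule.dense_iff_topologicalClosure_eq_top]
    exact span_character_closure r
  · rintro _ ⟨x, rfl⟩
    exact h x

/-- The rotation `k ↦ k + s` of the torus. -/
def rotation (r s : ℝ) : C(Torus r, Torus r) where
  toFun k := k + (s : Torus r)
  continuous_toFun := by fun_prop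

@[simp] lemma rotation_apply (r s : ℝ) (k : Torus r) : rotation r s k = k + (s : Torus r) := rfl

/-- The translation `F_r⁻¹ exp(i s D_r) F_r` of `L²` of the torus by the real number `s`. -/
def translate (r : ℝ) [Fact (0 < r)] (s : ℝ) : LTwo r →L[ℂ] LTwo r :=
  ((fourierTransform r).symm.toContinuousLinearEquiv : EllTwo r →L[ℂ] LTwo r) ∘L expPosition r s ∘L
    ((fourierTransform r).toContinuousLinearEquiv : LTwo r →L[ℂ] EllTwo r)

lemma translate_apply (r : ℝ) [Fact (0 < r)] (s : ℝ) (ξ : LTwo r) :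
    translate r s ξ = (fourierTransform r).symm (expPosition r s (fourierTransform r ξ)) := rfl

lemma expPosition_add (r s t : ℝ) : expPosition r (s + t) = expPosition r s ∘L expPosition r t := by
  ext ξ x
  simp only [ContinuousLinearMap.comp_apply, expPosition_apply]
  rw [← mul_assoc, ← Complex.exp_add]
  congr 2
  push_cast
  ring

lemma expPosition_zero (r : ℝ) : expPosition r 0 = ContinuousLinearMap.id ℂ (EllTwo r) := by
  ext ξ x
  simp

lemma translate_add_apply (r : ℝ) [Fact (0 < r)] (s t : ℝ) (ξ : LTwo r) :
    translate r (s + t) ξ = translate r s (translate r t ξ) := by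
  simp [translate_apply, expPosition_add]

lemma translate_zero_apply (r : ℝ) [Fact (0 < r)] (ξ : LTwo r) : translate r 0 ξ = ξ := by
  simp [translate_apply, expPosition_zero]

@[simp] lemma translate_neg_apply (r : ℝ) [Fact (0 < r)] (s : ℝ) (ξ : LTwo r) :
    translate r s (translate r (-s) ξ) = ξ := by
  rw [← translate_add_apply, add_neg_cancel, translate_zero_apply]

@[simp] lemma translate_neg_apply' (r : ℝ) [Fact (0 < r)] (s : ℝ) (ξ : LTwo r) :
    translate r (-s) (translate r s ξ) = ξ := by
  rw [← translate_add_apply, neg_add_cancel, translate_zero_apply]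

lemma translate_characterLp (r : ℝ) [Fact (0 < r)] (s : ℝ) (x : Lattice r) :
    translate r s (characterLp r x) = cexp (I * s * (x : ℝ)) • characterLp r x := by
  classical
  rw [translate_apply, LinearIsometryEquiv.symm_apply_eq, map_smul, fourierTransform_characterLp]
  ext y
  rw [expPosition_apply, lp.coeFn_smul, Pi.smul_apply, smul_eq_mul]
  by_cases h : y = x
  · rw [h]
  · simp [lp.single_apply, h]

lemma character_comp_rotation (r : ℝ) [Fact (0 < r)] (s : ℝ) (x : Lattice r) :
    (character r x).comp (rotation r s) = cexp (I * s * (x : ℝ)) • character r x := by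
  ext k
  induction k using QuotientAddGroup.induction_on with
  | H k =>
    rw [ContinuousMap.comp_apply, rotation_apply, ContinuousMap.smul_apply, smul_eq_mul]
    change character r x ((k + s : ℝ) : Torus r) = _ * character r x (k : Torus r)
    rw [character_coe, character_coe, ← Complex.exp_add]
    congr 1
    push_cast
    ring

/-- Translations are covariant with respect to multiplication operators:
`T_s M[g] = M[g(· + s)] T_s`. -/
lemma translate_mulOp (r : ℝ) [Fact (0 < r)] (s : ℝ) (g : C(Torus r, ℂ)) :
    translate r s ∘L mulOp r g = mulOp r (g.comp (rotation r s)) ∘L translate r s := by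
  let A : C(Torus r, ℂ) →L[ℂ] (LTwo r →L[ℂ] LTwo r) :=
    (ContinuousLinearMap.compL ℂ _ _ _ (translate r s)).comp (mulOpL r)
  let B : C(Torus r, ℂ) →L[ℂ] (LTwo r →L[ℂ] LTwo r) :=
    (((ContinuousLinearMap.compL ℂ _ _ _).flip (translate r s)).comp (mulOpL r)).comp
      ⟨(ContinuousMap.compRightAlgHom ℂ ℂ (rotation r s)).toLinearMap,
        ContinuousMap.continuous_precomp (rotation r s)⟩
  suffices A = B from congrArg (fun A => A g) this
  refine clm_ext_character fun x => ?_
  change translate r s ∘L mulOp r (character r x) =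
    mulOp r ((character r x).comp (rotation r s)) ∘L translate r s
  refine clm_ext_characterLp fun y => ?_
  rw [ContinuousLinearMap.comp_apply, ContinuousLinearMap.comp_apply, mulOp_characterLp,
    translate_characterLp,
    translate_characterLp, map_smul, character_comp_rotation, ← mulOpL_apply, map_smul,
    _root_.smul_apply, mulOpL_apply, mulOp_characterLp, smul_smul, ← Complex.exp_add]
  congr 2
  push_cast
  ring

lemma translate_mulOp_apply (r : ℝ) [Fact (0 < r)] (s : ℝ) (g : C(Torus r, ℂ)) (ξ : LTwo r) :
    translate r s (mulOp r g ξ) = mulOp r (g.comp (rotation r s)) (translate r s ξ) :=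
  congrArg (fun A => A ξ) (translate_mulOp r s g)

/-- The conjugate `V(s) = T_s V T_{-s}` of an operator by translations. -/
def conjTranslate {r₁ r₂ : ℝ} [Fact (0 < r₁)] [Fact (0 < r₂)] (V : LTwo r₁ →L[ℂ] LTwo r₂) (s : ℝ) :
    LTwo r₁ →L[ℂ] LTwo r₂ :=
  translate r₂ s ∘L V ∘L translate r₁ (-s)

lemma conjTranslate_apply {r₁ r₂ : ℝ} [Fact (0 < r₁)] [Fact (0 < r₂)]
    (V : LTwo r₁ →L[ℂ] LTwo r₂) (s : ℝ) (ξ : LTwo r₁) :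
    conjTranslate V s ξ = translate r₂ s (V (translate r₁ (-s) ξ)) := rfl

lemma conjTranslate_zero {r₁ r₂ : ℝ} [Fact (0 < r₁)] [Fact (0 < r₂)]
    (V : LTwo r₁ →L[ℂ] LTwo r₂) : conjTranslate V 0 = V := by
  ext1 ξ
  rw [conjTranslate_apply, neg_zero, translate_zero_apply, translate_zero_apply]

/-- `V` intertwines multiplication by `f₁` with multiplication by `f₂`. -/
def Intertwines {r₁ r₂ : ℝ} [Fact (0 < r₁)] [Fact (0 < r₂)] (f₁ : C(Torus r₁, ℂ))
    (f₂ : C(Torus r₂, ℂ)) (V : LTwo r₁ →L[ℂ] LTwo r₂) : Prop :=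
  ∀ ξ, V (mulOp r₁ f₁ ξ) = mulOp r₂ f₂ (V ξ)

/-- `V(s)` intertwines the functions translated by `s`. -/
lemma Intertwines.shift {r₁ r₂ : ℝ} [Fact (0 < r₁)] [Fact (0 < r₂)] {f₁ : C(Torus r₁, ℂ)}
    {f₂ : C(Torus r₂, ℂ)} {V : LTwo r₁ →L[ℂ] LTwo r₂} (h : Intertwines f₁ f₂ V) (s : ℝ) :
    Intertwines (f₁.comp (rotation r₁ s)) (f₂.comp (rotation r₂ s)) (conjTranslate V s) := by
  intro ξ
  have hf : (f₁.comp (rotation r₁ s)).comp (rotation r₁ (-s)) = f₁ := by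
    ext k
    simp
  rw [conjTranslate_apply, translate_mulOp_apply r₁ (-s), conjTranslate_apply,
    ← translate_mulOp_apply r₂ s, ← h, hf]

/-! ### Functional calculus and supports of intertwiners -/

variable {r r₁ r₂ : ℝ} [hr : Fact (0 < r)] [Fact (0 < r₁)] [Fact (0 < r₂)]

/-- As `λ₁` and `λ₂` are unimodular, an intertwiner also intertwines their conjugates. -/
lemma Intertwines.conj {lam₁ : C(Torus r₁, Circle)} {lam₂ : C(Torus r₂, Circle)}
    {V : LTwo r₁ →L[ℂ] LTwo r₂} (h : Intertwines (toComplex lam₁) (toComplex lam₂) V) :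
    Intertwines (star (toComplex lam₁)) (star (toComplex lam₂)) V := by
  have hs : ∀ {r : ℝ} (lam : C(Torus r, Circle)), star (toComplex lam) * toComplex lam = 1 := by
    intro r lam
    ext k
    simpa [toComplex, Complex.normSq_eq_conj_mul_self] using
      (Complex.normSq_eq_conj_mul_self (z := (lam k : ℂ))).symm
  intro ξ
  calc V (mulOp r₁ (star (toComplex lam₁)) ξ)
      = mulOp r₂ (star (toComplex lam₂) * toComplex lam₂)
          (V (mulOp r₁ (star (toComplex lam₁)) ξ)) := by
        rw [hs, mulOp_one, ContinuousLinearMap.id_apply]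
    _ = mulOp r₂ (star (toComplex lam₂))
          (V (mulOp r₁ (star (toComplex lam₁) * toComplex lam₁) ξ)) := by
        rw [mulOp_mul_apply, ← h, mulOp_mul_apply, mulOp_comm_apply]
    _ = mulOp r₂ (star (toComplex lam₂)) (V ξ) := by
        rw [hs, mulOp_one, ContinuousLinearMap.id_apply]

lemma isClosed_setOf_intertwines (lam₁ : C(Torus r₁, Circle)) (lam₂ : C(Torus r₂, Circle))
    (V : LTwo r₁ →L[ℂ] LTwo r₂) :
    IsClosed {φ : C(Circle, ℂ) | Intertwines (φ.comp lam₁) (φ.comp lam₂) V} := by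
  have h : {φ : C(Circle, ℂ) | Intertwines (φ.comp lam₁) (φ.comp lam₂) V} =
      ⋂ ξ, {φ : C(Circle, ℂ) | V (mulOp r₁ (φ.comp lam₁) ξ) = mulOp r₂ (φ.comp lam₂) (V ξ)} := by
    ext φ
    simp [Intertwines]
  rw [h]
  refine isClosed_iInter fun ξ => isClosed_eq ?_ ?_
  · exact V.continuous.comp (((continuous_mulOp r₁).comp
      (ContinuousMap.continuous_precomp lam₁)).clm_apply continuous_const)
  · exact ((continuous_mulOp r₂).comp
      (ContinuousMap.continuous_precomp lam₂)).clm_apply continuous_const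

/-- Continuous functional calculus: an intertwiner of `λ₁` and `λ₂` intertwines `φ ∘ λ₁`
and `φ ∘ λ₂` for every continuous function `φ` on the circle. -/
lemma Intertwines.comp {lam₁ : C(Torus r₁, Circle)} {lam₂ : C(Torus r₂, Circle)}
    {V : LTwo r₁ →L[ℂ] LTwo r₂} (h : Intertwines (toComplex lam₁) (toComplex lam₂) V)
    (φ : C(Circle, ℂ)) : Intertwines (φ.comp lam₁) (φ.comp lam₂) V := by
  let z : C(Circle, ℂ) := ⟨fun w => (w : ℂ), continuous_subtype_val⟩
  have htop := ContinuousMap.starSubalgebra_topologicalClosure_eq_top_of_separatesPoints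
    (StarAlgebra.adjoin ℂ ({z} : Set C(Circle, ℂ))) (by
      intro w w' hw
      exact ⟨z, ⟨z, StarAlgebra.self_mem_adjoin_singleton ℂ z, rfl⟩,
        fun e => hw (Subtype.ext e)⟩)
  have hφ : φ ∈ (StarAlgebra.adjoin ℂ ({z} : Set C(Circle, ℂ))).topologicalClosure := by
    rw [htop]
    trivial
  refine closure_minimal ?_ (isClosed_setOf_intertwines lam₁ lam₂ V) hφ
  -- The star algebra generated by `z` is the algebra generated by `z` and its conjugate.
  intro ψ hψ
  change ψ ∈ Algebra.adjoin ℂ ({z} ∪ star {z}) at hψ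
  induction hψ using Algebra.adjoin_induction with
  | mem ψ hψ =>
    rcases hψ with hψ | hψ
    · rw [Set.mem_singleton_iff.1 hψ]
      exact h
    · rw [Set.mem_star, Set.mem_singleton_iff] at hψ
      rw [← star_star ψ, hψ]
      exact h.conj
  | algebraMap c =>
    intro ξ
    have hc : ∀ {r : ℝ} [Fact (0 < r)] (lam : C(Torus r, Circle)) (ξ : LTwo r),
        mulOp r ((algebraMap ℂ C(Circle, ℂ) c).comp lam) ξ = c • ξ := by
      intro r _ lam ξ
      have e : (algebraMap ℂ C(Circle, ℂ) c).comp lam = c • (1 : C(Torus r, ℂ)) := by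
        ext k
        simp
      rw [e, ← mulOpL_apply, map_smul, _root_.smul_apply, mulOpL_apply, mulOp_one,
        ContinuousLinearMap.id_apply]
    rw [hc, hc, map_smul]
  | add f g _ _ hf hg =>
    intro ξ
    have ha : ∀ {r : ℝ} [Fact (0 < r)] (lam : C(Torus r, Circle)) (ξ : LTwo r),
        mulOp r ((f + g).comp lam) ξ = mulOp r (f.comp lam) ξ + mulOp r (g.comp lam) ξ := by
      intro r _ lam ξ
      rw [ContinuousMap.add_comp, ← mulOpL_apply, map_add]
      rfl
    rw [ha, ha, map_add, hf, hg]
  | mul f g _ _ hf hg =>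
    intro ξ
    have ha : ∀ {r : ℝ} [Fact (0 < r)] (lam : C(Torus r, Circle)) (ξ : LTwo r),
        mulOp r ((f * g).comp lam) ξ = mulOp r (f.comp lam) (mulOp r (g.comp lam) ξ) := by
      intro r _ lam ξ
      rw [ContinuousMap.mul_comp, mulOp_mul_apply]
    rw [ha, ha, hf, hg]

/-- `ξ` vanishes almost everywhere outside `A`. -/
def SuppIn (ξ : LTwo r) (A : Set (Torus r)) : Prop :=
  ∀ᵐ k ∂(AddCircle.haarAddCircle : Measure (Torus r)), k ∉ A → ξ k = 0

lemma SuppIn.mono {ξ : LTwo r} {A B : Set (Torus r)} (h : SuppIn ξ A) (hAB : A ⊆ B) :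
    SuppIn ξ B := by
  filter_upwards [h] with k hk hkB
  exact hk fun hA => hkB (hAB hA)

lemma mulOp_eq_self {ξ : LTwo r} {A : Set (Torus r)} (h : SuppIn ξ A) {g : C(Torus r, ℂ)}
    (hg : ∀ k ∈ A, g k = 1) : mulOp r g ξ = ξ := by
  apply Lp.ext
  filter_upwards [mulOp_ae r g ξ, h] with k h1 h2
  rw [h1]
  by_cases hk : k ∈ A
  · rw [hg k hk, one_mul]
  · rw [h2 hk, mul_zero]

/-- An intertwiner maps functions supported where `λ₁` takes values in a closed set `C` to functions
supported where `λ₂` takes values in `C`. -/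
lemma Intertwines.suppIn {lam₁ : C(Torus r₁, Circle)} {lam₂ : C(Torus r₂, Circle)}
    {V : LTwo r₁ →L[ℂ] LTwo r₂} (h : Intertwines (toComplex lam₁) (toComplex lam₂) V)
    {C : Set Circle} (hC : IsClosed C) {ξ : LTwo r₁} (hξ : SuppIn ξ (lam₁ ⁻¹' C)) :
    SuppIn (V ξ) (lam₂ ⁻¹' C) := by
  rcases C.eq_empty_or_nonempty with rfl | hne
  · have h0 : ξ = 0 := by
      apply Lp.ext
      filter_upwards [hξ, Lp.coeFn_zero ℂ 2 (AddCircle.haarAddCircle : Measure (Torus r₁))]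
        with k hk h0
      rw [h0]
      exact hk (by simp)
    rw [h0, map_zero]
    filter_upwards [Lp.coeFn_zero ℂ 2 (AddCircle.haarAddCircle : Measure (Torus r₂))] with k hk _
    exact hk
  -- `φ n` equals `1` on `C` and vanishes at distance `1 / n` from `C`.
  let φ : ℕ → C(Circle, ℂ) := fun n =>
    ⟨fun w => ((max 0 (1 - n * Metric.infDist w C) : ℝ) : ℂ), by
      have := Metric.continuous_infDist_pt C
      fun_prop⟩
  have hV : ∀ n, V ξ = mulOp r₂ ((φ n).comp lam₂) (V ξ) := by
    intro n
    rw [← h.comp (φ n), mulOp_eq_self hξ]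
    intro k hk
    simp [φ, Metric.infDist_zero_of_mem (show lam₁ k ∈ C from hk)]
  have hall : ∀ᵐ k ∂(AddCircle.haarAddCircle : Measure (Torus r₂)),
      ∀ n, V ξ k = φ n (lam₂ k) * V ξ k := by
    refine ae_all_iff.2 fun n => ?_
    filter_upwards [mulOp_ae r₂ ((φ n).comp lam₂) (V ξ)] with k hk
    rw [← hV n] at hk
    exact hk
  filter_upwards [hall] with k hk hkC
  have hpos : 0 < Metric.infDist (lam₂ k) C := (hC.notMem_iff_infDist_pos hne).1 hkC
  obtain ⟨n, hn⟩ := exists_nat_gt (Metric.infDist (lam₂ k) C)⁻¹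
  have hn' : 1 - n * Metric.infDist (lam₂ k) C ≤ 0 := by
    have := (inv_lt_iff_one_lt_mul₀ hpos).1 hn
    linarith
  rw [hk n]
  simp [φ, max_eq_left hn']

/-! ### The basic estimate for uniform intertwiners -/

lemma integrable_norm_sq (ξ : LTwo r) :
    Integrable (fun k => ‖ξ k‖ ^ 2) (AddCircle.haarAddCircle : Measure (Torus r)) :=
  (Lp.memLp ξ).integrable_norm_pow (by norm_num)

lemma norm_sq_eq_integral (ξ : LTwo r) :
    ‖ξ‖ ^ 2 = ∫ k, ‖ξ k‖ ^ 2 ∂(AddCircle.haarAddCircle : Measure (Torus r)) := by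
  have h : inner ℂ ξ ξ = ((‖ξ‖ ^ 2 : ℝ) : ℂ) := by
    rw [inner_self_eq_norm_sq_to_K]
    push_cast
    rfl
  have h2 := L2.inner_def (𝕜 := ℂ) ξ ξ
  rw [h] at h2
  have h3 : ∀ k, inner ℂ (ξ k) (ξ k) = ((‖ξ k‖ ^ 2 : ℝ) : ℂ) := by
    intro k
    rw [inner_self_eq_norm_sq_to_K]
    push_cast
    rfl
  simp only [h3] at h2
  rw [integral_complex_ofReal] at h2
  exact_mod_cast h2

/-- A finite partition of unity on the circle, subordinate to balls of radius `δ`. -/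
lemma exists_partition_circle {δ : ℝ} (hδ : 0 < δ) :
    ∃ (n : ℕ) (c : Fin n → Circle) (φ : Fin n → C(Circle, ℝ)),
      (∀ i w, 0 ≤ φ i w) ∧ (∀ w, ∑ i, φ i w = 1) ∧
      ∀ i w, w ∉ Metric.closedBall (c i) δ → φ i w = 0 := by
  obtain ⟨t, -, htf, ht⟩ := (isCompact_univ (X := Circle)).finite_cover_balls hδ
  obtain ⟨n, e, -, he⟩ := htf.fin_param
  obtain ⟨f, hf1, hf2, hf3, -⟩ := exists_continuous_sum_one_of_isOpen_isCompact
    (s := fun i => Metric.ball (e i) δ) (fun i => Metric.isOpen_ball)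
    (isCompact_univ (X := Circle)) (by
      intro w hw
      obtain ⟨c, hc, hwc⟩ := Set.mem_iUnion₂.1 (ht hw)
      rw [← he] at hc
      obtain ⟨i, rfl⟩ := hc
      exact Set.mem_iUnion.2 ⟨i, hwc⟩)
  refine ⟨n, e, f, fun i w => (hf3 i w).1, fun w => ?_, fun i w hw => ?_⟩
  · have := hf2 (Set.mem_univ w)
    simpa using this
  · by_contra hne
    exact hw (Metric.ball_subset_closedBall (hf1 i (subset_tsupport _ hne)))

/-- The basic estimate: if on `J × I` the equations `λ₂(k) = λ₁(k')` and
`λ₂(k + s) = λ₁(k' + s)` have no common solution, then the images under `V` and its conjugate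
`V(s)` of functions living on small level sets of `λ₁` have disjoint supports within `J`,
so `V` from `I` to `J` is bounded by `V(s) - V`. -/
lemma Intertwines.integral_le {lam₁ : C(Torus r₁, Circle)} {lam₂ : C(Torus r₂, Circle)}
    {V : LTwo r₁ →L[ℂ] LTwo r₂} (h : Intertwines (toComplex lam₁) (toComplex lam₂) V)
    {J : Set (Torus r₂)} {I : Set (Torus r₁)} (hJ : IsClosed J) (hI : IsClosed I) (s : ℝ)
    (hs : ∀ k ∈ J, ∀ k' ∈ I, lam₂ k = lam₁ k' → lam₂ (k + s) ≠ lam₁ (k' + s))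
    {ξ : LTwo r₁} (hξ : SuppIn ξ I) :
    ∫ k in J, ‖V ξ k‖ ^ 2 ∂(AddCircle.haarAddCircle : Measure (Torus r₂)) ≤
      ‖conjTranslate V s - V‖ ^ 2 * ‖ξ‖ ^ 2 := by
  -- By compactness, `λ₂(k)` and `λ₁(k')` stay at least `3δ` apart where the second equation holds.
  obtain ⟨δ, hδ, hsep⟩ : ∃ δ > 0, ∀ k ∈ J, ∀ k' ∈ I, lam₂ (k + s) = lam₁ (k' + s) →
      3 * δ ≤ dist (lam₂ k) (lam₁ k') := by
    let K : Set (Torus r₂ × Torus r₁) :=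
      (J ×ˢ I) ∩ {p | lam₂ (p.1 + s) = lam₁ (p.2 + s)}
    have hK : IsCompact K := by
      refine ((hJ.prod hI).inter (isClosed_eq ?_ ?_)).isCompact
      · exact lam₂.continuous.comp (continuous_fst.add continuous_const)
      · exact lam₁.continuous.comp (continuous_snd.add continuous_const)
    rcases K.eq_empty_or_nonempty with he | hne
    · refine ⟨1, one_pos, fun k hk k' hk' e => ?_⟩
      have : (k, k') ∈ K := ⟨⟨hk, hk'⟩, e⟩
      rw [he] at this
      exact this.elim
    · obtain ⟨p, hp, hmin⟩ := hK.exists_isMinOn hne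
        (f := fun p => dist (lam₂ p.1) (lam₁ p.2)) (by fun_prop)
      have hpos : 0 < dist (lam₂ p.1) (lam₁ p.2) := by
        refine dist_pos.2 fun e => ?_
        exact hs p.1 hp.1.1 p.2 hp.1.2 e hp.2
      refine ⟨dist (lam₂ p.1) (lam₁ p.2) / 3, by linarith, fun k hk k' hk' e => ?_⟩
      have h1 : dist (lam₂ p.1) (lam₁ p.2) ≤ dist (lam₂ k) (lam₁ k') :=
        hmin (show (k, k') ∈ K from ⟨⟨hk, hk'⟩, e⟩)
      linarith
  obtain ⟨n, c, φ, hφ0, hφ1, hφs⟩ := exists_partition_circle hδ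
  -- The pieces `ζ i = √(φ i)(λ₁) ξ` of `ξ` have square norms adding up to that of `ξ`, and so do
  -- their images `V (ζ i) = √(φ i)(λ₂) V ξ` on `J`.
  let ψ : Fin n → C(Circle, ℂ) := fun i => ⟨fun w => ((Real.sqrt (φ i w) : ℝ) : ℂ), by fun_prop⟩
  have hψ : ∀ i w, ‖ψ i w‖ ^ 2 = φ i w := by
    intro i w
    simp [ψ, Real.sq_sqrt (hφ0 i w)]
  let ζ : Fin n → LTwo r₁ := fun i => mulOp r₁ ((ψ i).comp lam₁) ξ
  have hζ : ∀ i, ∀ᵐ k ∂(AddCircle.haarAddCircle : Measure (Torus r₁)),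
      ‖ζ i k‖ ^ 2 = φ i (lam₁ k) * ‖ξ k‖ ^ 2 := by
    intro i
    filter_upwards [mulOp_ae r₁ ((ψ i).comp lam₁) ξ] with k hk
    rw [hk, norm_mul, mul_pow, ← hψ]
    rfl
  have hVζ : ∀ i, ∀ᵐ k ∂(AddCircle.haarAddCircle : Measure (Torus r₂)),
      ‖V (ζ i) k‖ ^ 2 = φ i (lam₂ k) * ‖V ξ k‖ ^ 2 := by
    intro i
    filter_upwards [mulOp_ae r₂ ((ψ i).comp lam₂) (V ξ)] with k hk
    rw [h.comp (ψ i), hk, norm_mul, mul_pow, ← hψ]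
    rfl
  have hsupp : ∀ i, SuppIn (ζ i) (I ∩ lam₁ ⁻¹' Metric.closedBall (c i) δ) := by
    intro i
    filter_upwards [mulOp_ae r₁ ((ψ i).comp lam₁) ξ, hξ] with k hk hkI hmem
    rw [hk]
    by_cases hkI' : k ∈ I
    · have h0 : ψ i (lam₁ k) = 0 := by
        have := hφs i (lam₁ k) fun hc => hmem ⟨hkI', hc⟩
        simp [ψ, this]
      rw [ContinuousMap.comp_apply, h0, zero_mul]
    · rw [hkI hkI', mul_zero]
  -- On `J`, at almost every point `V (ζ i)` or `V(s) (ζ i)` vanishes.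
  have hle : ∀ i, ∀ᵐ k ∂((AddCircle.haarAddCircle : Measure (Torus r₂)).restrict J),
      ‖V (ζ i) k‖ ^ 2 ≤ ‖(conjTranslate V s - V) (ζ i) k‖ ^ 2 := by
    intro i
    let I' := I ∩ lam₁ ⁻¹' Metric.closedBall (c i) δ
    have hI' : IsClosed I' := hI.inter (Metric.isClosed_closedBall.preimage lam₁.continuous)
    let C : Set Circle := (lam₁.comp (rotation r₁ s)) '' I'
    have hC : IsClosed C := (hI'.isCompact.image (lam₁.comp (rotation r₁ s)).continuous).isClosed
    have h1 : SuppIn (V (ζ i)) (lam₂ ⁻¹' Metric.closedBall (c i) δ) :=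
      h.suppIn Metric.isClosed_closedBall ((hsupp i).mono Set.inter_subset_right)
    have h' : Intertwines (toComplex (lam₁.comp (rotation r₁ s)))
        (toComplex (lam₂.comp (rotation r₂ s))) (conjTranslate V s) := h.shift s
    have h2 : SuppIn (conjTranslate V s (ζ i)) ((lam₂.comp (rotation r₂ s)) ⁻¹' C) :=
      h'.suppIn hC ((hsupp i).mono fun k hk => ⟨k, hk, rfl⟩)
    filter_upwards [ae_restrict_of_ae h1, ae_restrict_of_ae h2, ae_restrict_mem hJ.measurableSet,
      ae_restrict_of_ae (Lp.coeFn_sub (conjTranslate V s (ζ i)) (V (ζ i)))] with k hk1 hk2 hkJ hsub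
    rw [_root_.sub_apply, hsub, Pi.sub_apply]
    by_cases hb : k ∈ lam₂ ⁻¹' Metric.closedBall (c i) δ
    · rw [hk2, zero_sub, norm_neg]
      rintro ⟨k', ⟨hk'I, hk'b⟩, e⟩
      have h3 := hsep k hkJ k' hk'I e.symm
      have h4 := dist_triangle_right (lam₂ k) (lam₁ k') (c i)
      have h5 : dist (lam₂ k) (c i) ≤ δ := hb
      have h6 : dist (lam₁ k') (c i) ≤ δ := hk'b
      linarith
    · rw [hk1 hb]
      simp
  have hint : ∀ i, ∫ k in J, ‖V (ζ i) k‖ ^ 2 ∂(AddCircle.haarAddCircle : Measure (Torus r₂)) ≤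
      ‖conjTranslate V s - V‖ ^ 2 * ‖ζ i‖ ^ 2 := by
    intro i
    calc ∫ k in J, ‖V (ζ i) k‖ ^ 2 ∂(AddCircle.haarAddCircle : Measure (Torus r₂))
        ≤ ∫ k in J, ‖(conjTranslate V s - V) (ζ i) k‖ ^ 2
            ∂(AddCircle.haarAddCircle : Measure (Torus r₂)) :=
          integral_mono_ae (integrable_norm_sq _).integrableOn
            (integrable_norm_sq _).integrableOn (hle i)
      _ ≤ ∫ k, ‖(conjTranslate V s - V) (ζ i) k‖ ^ 2
            ∂(AddCircle.haarAddCircle : Measure (Torus r₂)) :=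
          setIntegral_le_integral (integrable_norm_sq _)
            (Eventually.of_forall fun k => by positivity)
      _ = ‖(conjTranslate V s - V) (ζ i)‖ ^ 2 := (norm_sq_eq_integral _).symm
      _ ≤ (‖conjTranslate V s - V‖ * ‖ζ i‖) ^ 2 :=
          pow_le_pow_left₀ (norm_nonneg _) (ContinuousLinearMap.le_opNorm _ _) 2
      _ = _ := mul_pow _ _ _
  have hsum₁ : ‖ξ‖ ^ 2 = ∑ i, ‖ζ i‖ ^ 2 := by
    simp only [norm_sq_eq_integral]
    rw [← integral_finsetSum _ fun i _ => integrable_norm_sq (ζ i)]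
    refine integral_congr_ae ?_
    filter_upwards [ae_all_iff.2 hζ] with k hk
    simp only [hk, ← Finset.sum_mul, hφ1, one_mul]
  have hsum₂ : ∫ k in J, ‖V ξ k‖ ^ 2 ∂(AddCircle.haarAddCircle : Measure (Torus r₂)) =
      ∑ i, ∫ k in J, ‖V (ζ i) k‖ ^ 2 ∂(AddCircle.haarAddCircle : Measure (Torus r₂)) := by
    rw [← integral_finsetSum _ fun i _ => (integrable_norm_sq (V (ζ i))).integrableOn]
    refine integral_congr_ae (ae_restrict_of_ae ?_)
    filter_upwards [ae_all_iff.2 hVζ] with k hk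
    simp only [hk, ← Finset.sum_mul, hφ1, one_mul]
  rw [hsum₁, hsum₂, Finset.mul_sum]
  exact Finset.sum_le_sum fun i _ => hint i

/-- `V` is uniform with respect to translations: `s ↦ T_s V T_{-s}` is norm continuous. -/
def UniformOp (V : LTwo r₁ →L[ℂ] LTwo r₂) : Prop := Continuous (conjTranslate V)

/-- If the hypothesis of the basic estimate holds for arbitrarily small `s`, then a uniform
intertwiner vanishes from `I` to `J`. -/
lemma Intertwines.ae_eq_zero {lam₁ : C(Torus r₁, Circle)} {lam₂ : C(Torus r₂, Circle)}
    {V : LTwo r₁ →L[ℂ] LTwo r₂} (h : Intertwines (toComplex lam₁) (toComplex lam₂) V)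
    (hu : UniformOp V) {J : Set (Torus r₂)} {I : Set (Torus r₁)} (hJ : IsClosed J)
    (hI : IsClosed I)
    (hs : ∃ᶠ s : ℝ in 𝓝 0, ∀ k ∈ J, ∀ k' ∈ I, lam₂ k = lam₁ k' →
      lam₂ (k + s) ≠ lam₁ (k' + s))
    {ξ : LTwo r₁} (hξ : SuppIn ξ I) : SuppIn (V ξ) Jᶜ := by
  have hlim : Tendsto (fun s => ‖conjTranslate V s - V‖ ^ 2 * ‖ξ‖ ^ 2) (𝓝 0) (𝓝 0) := by
    have h1 : Tendsto (fun s => conjTranslate V s - V) (𝓝 0) (𝓝 (V - V)) := by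
      have := (hu.tendsto 0).sub_const V
      rwa [conjTranslate_zero] at this
    rw [sub_self] at h1
    simpa using (h1.norm.pow 2).mul_const (‖ξ‖ ^ 2)
  have hle : ∫ k in J, ‖V ξ k‖ ^ 2 ∂(AddCircle.haarAddCircle : Measure (Torus r₂)) ≤ 0 := by
    by_contra hpos
    obtain ⟨s, hs1, hs2⟩ := (hs.and_eventually (hlim.eventually_lt_const (not_le.1 hpos))).exists
    exact absurd (h.integral_le hJ hI s hs1 hξ) (not_le.2 hs2)
  have h0 := (integral_eq_zero_iff_of_nonneg_ae (Eventually.of_forall fun k => by positivity)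
    (integrable_norm_sq (V ξ)).integrableOn).1 (le_antisymm hle
      (integral_nonneg fun k => by positivity))
  have h1 := (ae_restrict_iff' hJ.measurableSet).1 h0
  filter_upwards [h1] with k hk hkJ
  have := hk (by simpa using hkJ)
  simpa using this

/-! ### Vanishing between sets and its local nature -/

/-- The restriction `χ_A ξ` of a vector of `L²` to a measurable set `A`. -/
def cutoff (A : Set (Torus r)) (hA : MeasurableSet A) (ξ : LTwo r) : LTwo r :=
  ((Lp.memLp ξ).indicator hA).toLp _

lemma cutoff_ae (A : Set (Torus r)) (hA : MeasurableSet A) (ξ : LTwo r) :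
    cutoff A hA ξ =ᵐ[AddCircle.haarAddCircle] A.indicator ξ :=
  MemLp.coeFn_toLp _

lemma suppIn_cutoff (A : Set (Torus r)) (hA : MeasurableSet A) (ξ : LTwo r) :
    SuppIn (cutoff A hA ξ) A := by
  filter_upwards [cutoff_ae A hA ξ] with k hk hkA
  rw [hk, Set.indicator_of_notMem hkA]

lemma inner_eq_zero_of_suppIn {ξ η : LTwo r} {A : Set (Torus r)} (h : SuppIn ξ A)
    (h' : SuppIn η Aᶜ) : inner ℂ η ξ = 0 := by
  rw [L2.inner_def]
  refine (integral_congr_ae ?_).trans (integral_zero _ _)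
  filter_upwards [h, h'] with k h1 h2
  by_cases hk : k ∈ A
  · rw [h2 (not_not.2 hk), inner_zero_left]
  · rw [h1 hk, inner_zero_right]

lemma suppIn_compl_of_inner {ξ : LTwo r} {A : Set (Torus r)} (hA : MeasurableSet A)
    (h : ∀ η, SuppIn η A → inner ℂ η ξ = 0) : SuppIn ξ Aᶜ := by
  have h1 := h _ (suppIn_cutoff A hA ξ)
  have h2 : inner ℂ (cutoff A hA ξ) (cutoff A hA ξ) = 0 := by
    rw [← h1, L2.inner_def, L2.inner_def]
    refine integral_congr_ae ?_
    filter_upwards [cutoff_ae A hA ξ] with k hk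
    rw [hk]
    by_cases hkA : k ∈ A
    · rw [Set.indicator_of_mem hkA]
    · rw [Set.indicator_of_notMem hkA, inner_zero_left, inner_zero_left]
  have h3 : cutoff A hA ξ = 0 := inner_self_eq_zero.1 h2
  have h4 := cutoff_ae A hA ξ
  rw [h3] at h4
  filter_upwards [h4, Lp.coeFn_zero ℂ 2 (AddCircle.haarAddCircle : Measure (Torus r))]
    with k hk h0 hkA
  rw [h0, Set.indicator_of_mem (not_not.1 hkA)] at hk
  exact hk.symm

/-- The matrix coefficients of `V` from functions supported in `I` to functions supported in `J`
vanish, i.e. `χ_J V χ_I = 0`. -/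
def Vanishes (V : LTwo r₁ →L[ℂ] LTwo r₂) (J : Set (Torus r₂)) (I : Set (Torus r₁)) : Prop :=
  ∀ ξ η, SuppIn ξ I → SuppIn η J → inner ℂ η (V ξ) = 0

lemma Vanishes.mono {V : LTwo r₁ →L[ℂ] LTwo r₂} {J J' : Set (Torus r₂)} {I I' : Set (Torus r₁)}
    (h : Vanishes V J I) (hJ : J' ⊆ J) (hI : I' ⊆ I) : Vanishes V J' I' :=
  fun ξ η hξ hη => h ξ η (hξ.mono hI) (hη.mono hJ)

lemma vanishes_of_suppIn {V : LTwo r₁ →L[ℂ] LTwo r₂} {J : Set (Torus r₂)} {I : Set (Torus r₁)}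
    (h : ∀ ξ, SuppIn ξ I → SuppIn (V ξ) Jᶜ) : Vanishes V J I :=
  fun ξ _ hξ hη => inner_eq_zero_of_suppIn (h ξ hξ) (hη.mono (compl_compl J).ge)

lemma Vanishes.suppIn {V : LTwo r₁ →L[ℂ] LTwo r₂} {J : Set (Torus r₂)} {I : Set (Torus r₁)}
    (h : Vanishes V J I) (hJ : MeasurableSet J) {ξ : LTwo r₁} (hξ : SuppIn ξ I) :
    SuppIn (V ξ) Jᶜ :=
  suppIn_compl_of_inner hJ fun η hη => h ξ η hξ hη

lemma Vanishes.adjoint {V : LTwo r₁ →L[ℂ] LTwo r₂} {J : Set (Torus r₂)} {I : Set (Torus r₁)}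
    (h : Vanishes V J I) : Vanishes (ContinuousLinearMap.adjoint V) I J := by
  intro η ξ hη hξ
  rw [ContinuousLinearMap.adjoint_inner_right, ← inner_conj_symm, h ξ η hξ hη, map_zero]

lemma vanishes_adjoint {V : LTwo r₁ →L[ℂ] LTwo r₂} {J : Set (Torus r₂)} {I : Set (Torus r₁)} :
    Vanishes (ContinuousLinearMap.adjoint V) I J ↔ Vanishes V J I := by
  refine ⟨fun h => ?_, fun h => h.adjoint⟩
  have h' := h.adjoint
  rwa [ContinuousLinearMap.adjoint_adjoint] at h'

/-- Vanishing from `I` to `J` is local: it suffices to check it near all points of `J × I`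
outside a null set of points of `I`. -/
lemma vanishes_of_locally {V : LTwo r₁ →L[ℂ] LTwo r₂} {J : Set (Torus r₂)} {I : Set (Torus r₁)}
    (hJ : IsClosed J) {N : Set (Torus r₁)}
    (hN : (AddCircle.haarAddCircle : Measure (Torus r₁)) N = 0)
    (hloc : ∀ k ∈ J, ∀ k' ∈ I, k' ∉ N → ∃ U ∈ 𝓝 k, ∃ U' ∈ 𝓝 k', Vanishes V U U') :
    Vanishes V J I := by
  -- By compactness of `J`, `V` vanishes from a neighbourhood of `k'` to all of `J`.
  have h1 : ∀ k' ∈ I, k' ∉ N → ∃ U' ∈ 𝓝 k', ∀ ξ, SuppIn ξ U' → SuppIn (V ξ) Jᶜ := by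
    intro k' hk' hk'N
    refine hJ.isCompact.induction_on
      (p := fun S => ∃ U' ∈ 𝓝 k', ∀ ξ, SuppIn ξ U' → SuppIn (V ξ) Sᶜ) ?_ ?_ ?_ ?_
    · exact ⟨Set.univ, univ_mem, fun ξ _ => Eventually.of_forall fun k hk => absurd hk (by simp)⟩
    · rintro S S' hS ⟨U', hU', h⟩
      exact ⟨U', hU', fun ξ hξ => (h ξ hξ).mono (Set.compl_subset_compl.2 hS)⟩
    · rintro S S' ⟨U, hU, h⟩ ⟨U', hU', h'⟩
      refine ⟨U ∩ U', inter_mem hU hU', fun ξ hξ => ?_⟩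
      filter_upwards [h ξ (hξ.mono Set.inter_subset_left),
        h' ξ (hξ.mono Set.inter_subset_right)] with k hk hk' hkS
      rcases not_not.1 hkS with hS | hS
      · exact hk (not_not.2 hS)
      · exact hk' (not_not.2 hS)
    · intro k hk
      obtain ⟨U, hU, U', hU', h⟩ := hloc k hk k' hk' hk'N
      exact ⟨interior U, mem_nhdsWithin_of_mem_nhds (interior_mem_nhds.2 hU), U', hU',
        fun ξ hξ => (h.mono interior_subset le_rfl).suppIn isOpen_interior.measurableSet hξ⟩
  -- For the adjoint this is the vanishing of a function near `k'`, which globalizes to `I`.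
  refine vanishes_adjoint.1 (vanishes_of_suppIn fun η hη => ?_)
  have h2 : (AddCircle.haarAddCircle : Measure (Torus r₁))
      {k' | (k' ∈ I ∧ k' ∉ N) ∧ ContinuousLinearMap.adjoint V η k' ≠ 0} = 0 := by
    refine measure_null_of_locally_null _ ?_
    rintro k' ⟨⟨hk', hk'N⟩, -⟩
    obtain ⟨U', hU', h⟩ := h1 k' hk' hk'N
    have h3 := (((vanishes_of_suppIn h).mono le_rfl interior_subset).adjoint).suppIn
      isOpen_interior.measurableSet hη
    refine ⟨interior U' ∩ {k' | (k' ∈ I ∧ k' ∉ N) ∧ ContinuousLinearMap.adjoint V η k' ≠ 0},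
      inter_mem (mem_nhdsWithin_of_mem_nhds (interior_mem_nhds.2 hU')) self_mem_nhdsWithin,
      measure_mono_null ?_ h3⟩
    rintro k ⟨hk1, -, hk2⟩ hk3
    exact hk2 (hk3 (not_not.2 hk1))
  filter_upwards [measure_eq_zero_iff_ae_notMem.1 h2, measure_eq_zero_iff_ae_notMem.1 hN]
    with k hk hkN hkI
  by_contra hne
  exact hk ⟨⟨not_not.1 hkI, hkN⟩, hne⟩

/-! ### Pairs of analytic functions with equal values and derivatives -/

/-- An uncountable set of reals accumulates at one of its points. -/
lemma exists_frequently_mem_of_not_countable {A : Set ℝ} (hA : ¬ A.Countable) :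
    ∃ x ∈ A, ∃ᶠ y in 𝓝[≠] x, y ∈ A := by
  by_contra! h
  apply hA
  have : DiscreteTopology A := by
    refine discreteTopology_subtype_iff.2 fun x hx => ?_
    rw [← disjoint_iff, disjoint_principal_right]
    exact (h x hx).mono fun y hy => hy
  exact Set.countable_coe_iff.1
    (TopologicalSpace.separableSpace_iff_countable.1 inferInstance)

/-- Two real analytic functions of one variable whose values and derivatives agree along pairs
of points accumulating at a pair of noncritical points differ by a shift of the variable: the
transition function `y₁⁻¹ ∘ y₂` is analytic with derivative `1` on an accumulating set. -/
lemma eventually_eq_shift {y₁ y₂ : ℝ → ℝ} {a b : ℝ} (h₁ : AnalyticAt ℝ y₁ b)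
    (h₂ : AnalyticAt ℝ y₂ a) (hab : y₂ a = y₁ b) (hb : deriv y₁ b ≠ 0) {u v : ℕ → ℝ}
    (hu : Tendsto u atTop (𝓝 a)) (hv : Tendsto v atTop (𝓝 b)) (hvb : ∀ n, v n ≠ b)
    (huv : ∀ n, y₂ (u n) = y₁ (v n)) (huv' : ∀ n, deriv y₂ (u n) = deriv y₁ (v n)) :
    ∀ᶠ k in 𝓝 a, y₂ k = y₁ (k + (b - a)) := by
  let g : ℝ → ℝ := h₁.hasStrictDerivAt.localInverse _ _ _ hb
  have hg : AnalyticAt ℝ g (y₂ a) := by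
    rw [hab]
    exact h₁.analyticAt_localInverse hb
  have hgl : ∀ᶠ x in 𝓝 b, g (y₁ x) = x := HasStrictDerivAt.eventually_left_inverse ..
  have hgr : ∀ᶠ x in 𝓝 (y₂ a), y₁ (g x) = x := by
    rw [hab]
    exact HasStrictDerivAt.eventually_right_inverse ..
  let γ : ℝ → ℝ := fun k => g (y₂ k)
  have hγ : AnalyticAt ℝ γ a := hg.comp h₂
  have hγa : γ a = b := by
    change g (y₂ a) = b
    rw [hab]
    exact hgl.self_of_nhds
  have hγr : ∀ᶠ k in 𝓝 a, y₁ (γ k) = y₂ k := h₂.continuousAt.eventually hgr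
  have hγc : Tendsto γ (𝓝 a) (𝓝 b) := by
    have := hγ.continuousAt.tendsto
    rwa [hγa] at this
  have hγu : ∀ᶠ n in atTop, γ (u n) = v n := by
    filter_upwards [hv.eventually hgl] with n hn
    change g (y₂ (u n)) = v n
    rw [huv, hn]
  have hchain : ∀ᶠ k in 𝓝 a, deriv y₁ (γ k) * deriv γ k = deriv y₂ k := by
    filter_upwards [hγr.eventually_nhds, hγc.eventually h₁.eventually_analyticAt,
      hγ.eventually_analyticAt] with k hk hk1 hk2
    have hd := hk1.differentiableAt.hasDerivAt.comp k hk2.differentiableAt.hasDerivAt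
    exact (hd.deriv.symm.trans (EventuallyEq.deriv_eq hk))
  have hne : ∀ᶠ k in 𝓝 b, deriv y₁ k ≠ 0 := h₁.deriv.continuousAt.eventually_ne hb
  have hfreq : ∃ᶠ k in 𝓝[≠] a, deriv γ k - 1 = 0 := by
    have hu' : Tendsto u atTop (𝓝[≠] a) := by
      refine tendsto_nhdsWithin_iff.2 ⟨hu, ?_⟩
      filter_upwards [hγu] with n hn hna
      rw [Set.mem_singleton_iff.1 hna, hγa] at hn
      exact hvb n hn.symm
    refine hu'.frequently (Eventually.frequently ?_)
    filter_upwards [hγu, hu.eventually hchain, hv.eventually hne] with n hn hc hv0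
    rw [hn, huv'] at hc
    rw [sub_eq_zero]
    exact mul_left_cancel₀ hv0 (hc.trans (mul_one _).symm)
  have hev : ∀ᶠ k in 𝓝 a, deriv γ k - 1 = 0 :=
    ((hγ.deriv.sub analyticAt_const).frequently_zero_iff_eventually_zero).1 hfreq
  obtain ⟨ε, hε, hball⟩ := Metric.eventually_nhds_iff_ball.1
    (hev.and hγ.eventually_analyticAt)
  have hshift : ∀ k ∈ Metric.ball a ε, γ k - k = γ a - a := by
    intro k hk
    refine Metric.isOpen_ball.is_const_of_deriv_eq_zero (f := fun k => γ k - k)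
      (convex_ball a ε).isPreconnected ?_ ?_ hk (Metric.mem_ball_self hε)
    · exact fun x hx => ((hball x hx).2.differentiableAt.sub
        differentiableAt_id).differentiableWithinAt
    · intro x hx
      have h := (hball x hx).2.differentiableAt.hasDerivAt.sub (hasDerivAt_id x)
      exact h.deriv.trans (hball x hx).1
  filter_upwards [Metric.ball_mem_nhds a hε, hγr] with k hk hk2
  have := hshift k hk
  rw [hγa] at this
  rw [← hk2, show k + (b - a) = γ k by linarith]

/-- Two points of the unit circle with the same imaginary part and positive real parts agree. -/
lemma eq_of_im_eq_of_re_pos {z w : ℂ} (hz : ‖z‖ = 1) (hw : ‖w‖ = 1) (him : z.im = w.im)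
    (hz0 : 0 < z.re) (hw0 : 0 < w.re) : z = w := by
  have h1 := Complex.sq_norm z
  have h2 := Complex.sq_norm w
  rw [hz, Complex.normSq_apply] at h1
  rw [hw, Complex.normSq_apply, ← him] at h2
  refine Complex.ext ?_ him
  have h3 : (z.re - w.re) * (z.re + w.re) = 0 := by linarith
  rcases mul_eq_zero.1 h3 with h | h <;> linarith

/-- The derivative of a curve in the unit circle is orthogonal to the curve. -/
lemma re_conj_mul_deriv {L : ℝ → ℂ} (hL : ∀ t, ‖L t‖ = 1) {t : ℝ} (h : DifferentiableAt ℝ L t) :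
    ((starRingEnd ℂ) (L t) * deriv L t).re = 0 := by
  have h1 : HasDerivAt (fun t => ‖L t‖ ^ 2) (2 * inner ℝ (L t) (deriv L t)) t :=
    h.hasDerivAt.norm_sq
  have h2 : HasDerivAt (fun t => ‖L t‖ ^ 2) 0 t := by
    simp only [hL]
    exact hasDerivAt_const t _
  have h3 := h1.unique h2
  rw [Complex.inner] at h3
  rw [mul_comm] at h3 ⊢
  linarith

/-- If two analytic maps to the unit circle have equal values and equal derivatives along an
uncountable family of pairs of parameters, then they differ by a shift of the parameter. -/
theorem exists_shift_of_not_countable {L₁ L₂ : ℝ → ℂ} (h₁ : ∀ t, AnalyticAt ℝ L₁ t)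
    (h₂ : ∀ t, AnalyticAt ℝ L₂ t) (n₁ : ∀ t, ‖L₁ t‖ = 1) (n₂ : ∀ t, ‖L₂ t‖ = 1)
    (hnc : ∃ t, deriv L₁ t ≠ 0) {S : Set (ℝ × ℝ)} (hS : IsClosed S)
    (hval : ∀ p ∈ S, L₂ p.1 = L₁ p.2) (hder : ∀ p ∈ S, deriv L₂ p.1 = deriv L₁ p.2)
    {K K' : Set ℝ} (hK : IsCompact K)
    (hunc : ¬ {k' ∈ K' | ∃ k ∈ K, (k, k') ∈ S}.Countable) :
    ∃ p ∈ S, ∀ t, L₂ t = L₁ (t + (p.2 - p.1)) := by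
  have hcrit : {t | deriv L₁ t = 0}.Countable := by
    by_contra hc
    obtain ⟨x, -, hx⟩ := exists_frequently_mem_of_not_countable hc
    obtain ⟨t, ht⟩ := hnc
    exact ht (AnalyticOnNhd.eqOn_zero_of_preconnected_of_frequently_eq_zero (U := Set.univ)
      (fun t _ => (h₁ t).deriv) isPreconnected_univ (Set.mem_univ x) hx (Set.mem_univ t))
  -- Remove the countably many critical points before choosing an accumulation point.
  have hunc' : ¬ ({k' ∈ K' | ∃ k ∈ K, (k, k') ∈ S} \ {t | deriv L₁ t = 0}).Countable := by
    intro hc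
    refine hunc ((hc.union hcrit).mono fun x hx => ?_)
    by_cases hx0 : deriv L₁ x = 0
    · exact Or.inr hx0
    · exact Or.inl ⟨hx, hx0⟩
  obtain ⟨b, ⟨-, hb⟩, hfreq⟩ := exists_frequently_mem_of_not_countable hunc'
  change ¬ deriv L₁ b = 0 at hb
  obtain ⟨v, hv, hvS⟩ := exists_seq_forall_of_frequently
    (hfreq.and_eventually self_mem_nhdsWithin)
  have hvS' : ∀ n, ∃ k ∈ K, (k, v n) ∈ S := fun n => (hvS n).1.1.2
  choose u huK huS using hvS'
  obtain ⟨a, -, φ, hφ, hua⟩ := hK.tendsto_subseq huK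
  have hvb : Tendsto (v ∘ φ) atTop (𝓝 b) :=
    (tendsto_nhdsWithin_iff.1 hv).1.comp hφ.tendsto_atTop
  have hab : (a, b) ∈ S :=
    hS.mem_of_tendsto (hua.prodMk_nhds hvb) (Eventually.of_forall fun n => huS (φ n))
  refine ⟨(a, b), hab, ?_⟩
  -- The imaginary part of `L / L₁ b` is a real analytic coordinate.
  let c : ℂ := (starRingEnd ℂ) (L₁ b)
  have hc1 : c * L₁ b = 1 := by
    rw [← Complex.normSq_eq_conj_mul_self, Complex.normSq_eq_norm_sq, n₁]
    simp
  have hcn : ‖c‖ = 1 := by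
    rw [RCLike.norm_conj]
    exact n₁ b
  have han : ∀ {L : ℝ → ℂ} (_ : ∀ t, AnalyticAt ℝ L t) (t : ℝ),
      AnalyticAt ℝ (fun t => (c * L t).im) t := fun hL t =>
    (Complex.imCLM.analyticAt _).comp (analyticAt_const.mul (hL t))
  have hd : ∀ {L : ℝ → ℂ} (_ : ∀ t, AnalyticAt ℝ L t) (t : ℝ),
      deriv (fun t => (c * L t).im) t = (c * deriv L t).im := fun hL t =>
    (Complex.imCLM.hasFDerivAt.comp_hasDerivAt t
      ((hL t).differentiableAt.hasDerivAt.const_mul c)).deriv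
  have hloc : ∀ᶠ k in 𝓝 a, (c * L₂ k).im = (c * L₁ (k + (b - a))).im := by
    refine eventually_eq_shift (y₁ := fun t => (c * L₁ t).im) (y₂ := fun t => (c * L₂ t).im)
      (han h₁ b) (han h₂ a) ?_ ?_ hua hvb (fun n => (hvS (φ n)).2) (fun n => ?_) (fun n => ?_)
    · rw [hval _ hab]
    · rw [hd h₁]
      intro him
      have hre := re_conj_mul_deriv n₁ (h₁ b).differentiableAt
      have h0 : c * deriv L₁ b = 0 := Complex.ext hre him
      rcases mul_eq_zero.1 h0 with h | h
      · rw [h, norm_zero] at hcn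
        exact zero_ne_one hcn
      · exact hb h
    · change (c * L₂ (u (φ n))).im = (c * L₁ (v (φ n))).im
      rw [hval _ (huS (φ n))]
    · rw [hd h₁, hd h₂]
      change (c * deriv L₂ (u (φ n))).im = (c * deriv L₁ (v (φ n))).im
      rw [hder _ (huS (φ n))]
  have hsh : ∀ t, AnalyticAt ℝ (fun k => L₁ (k + (b - a))) t := fun t =>
    AnalyticAt.fun_comp (h₁ _) (analyticAt_id.add analyticAt_const)
  have hre₁ : ∀ᶠ k in 𝓝 a, 0 < (c * L₁ (k + (b - a))).re := by
    have hcont : ContinuousAt (fun k => (c * L₁ (k + (b - a))).re) a :=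
      Complex.continuous_re.continuousAt.comp (continuousAt_const.mul (hsh a).continuousAt)
    refine hcont.eventually (lt_mem_nhds ?_)
    change 0 < (c * L₁ (a + (b - a))).re
    rw [add_sub_cancel, hc1]
    exact one_pos
  have hre₂ : ∀ᶠ k in 𝓝 a, 0 < (c * L₂ k).re := by
    have hcont : ContinuousAt (fun k => (c * L₂ k).re) a :=
      Complex.continuous_re.continuousAt.comp (continuousAt_const.mul (h₂ a).continuousAt)
    refine hcont.eventually (lt_mem_nhds ?_)
    change 0 < (c * L₂ a).re
    rw [hval _ hab, hc1]
    exact one_pos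
  have heq : L₂ =ᶠ[𝓝 a] fun k => L₁ (k + (b - a)) := by
    filter_upwards [hloc, hre₁, hre₂] with k him hr1 hr2
    have hc0 : c ≠ 0 := fun h => by
      rw [h, norm_zero] at hcn
      exact zero_ne_one hcn
    refine mul_left_cancel₀ hc0 (eq_of_im_eq_of_re_pos ?_ ?_ him hr2 hr1)
    · rw [norm_mul, hcn, n₂, one_mul]
    · rw [norm_mul, hcn, n₁, one_mul]
  exact fun t => congrFun (AnalyticOnNhd.eq_of_eventuallyEq (fun t _ => h₂ t)
    (fun t _ => hsh t) heq) t

/-- Near a pair of parameters at which the values or the derivatives of `L₁`, `L₂` differ,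
the equations `L₂ k = L₁ k'` and `L₂ (k + s) = L₁ (k' + s)` are incompatible for small `s > 0`. -/
lemma exists_forall_ne_of_nonresonant {L₁ L₂ : ℝ → ℂ} (h₁ : ∀ t, AnalyticAt ℝ L₁ t)
    (h₂ : ∀ t, AnalyticAt ℝ L₂ t) {a b : ℝ} (hab : L₂ a = L₁ b → deriv L₂ a ≠ deriv L₁ b) :
    ∃ δ > 0, ∀ k ∈ Metric.closedBall a δ, ∀ k' ∈ Metric.closedBall b δ, L₂ k = L₁ k' →
      ∀ s, 0 < s → s < δ → L₂ (k + s) ≠ L₁ (k' + s) := by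
  by_cases hval : L₂ a = L₁ b
  · have hc := sub_ne_zero.2 (hab hval)
    set c : ℂ := deriv L₂ a - deriv L₁ b with hc_def
    have hcont : ContinuousAt (fun p : ℝ × ℝ => deriv L₂ p.1 - deriv L₁ p.2) (a, b) :=
      ContinuousAt.fun_sub
        (ContinuousAt.comp (x := (a, b)) (f := Prod.fst) (h₂ a).deriv.continuousAt continuousAt_fst)
        (ContinuousAt.comp (x := (a, b)) (f := Prod.snd) (h₁ b).deriv.continuousAt continuousAt_snd)
    obtain ⟨ε, hε, hball⟩ := Metric.continuousAt_iff.1 hcont (‖c‖ / 2)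
      (half_pos (norm_pos_iff.2 hc))
    refine ⟨ε / 3, by linarith, fun k hk k' hk' he s hs0 hs heq => ?_⟩
    rw [Metric.mem_closedBall, Real.dist_eq, abs_le] at hk hk'
    have hF : ∀ t, HasDerivAt (fun t : ℝ => L₂ (k + t) - L₁ (k' + t) - t * c)
        (deriv L₂ (k + t) - deriv L₁ (k' + t) - c) t := by
      intro t
      have e1 : HasDerivAt (fun t => L₂ (k + t)) (deriv L₂ (k + t)) t :=
        (h₂ (k + t)).differentiableAt.hasDerivAt.comp_const_add k t
      have e2 : HasDerivAt (fun t => L₁ (k' + t)) (deriv L₁ (k' + t)) t :=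
        (h₁ (k' + t)).differentiableAt.hasDerivAt.comp_const_add k' t
      have e3 : HasDerivAt (fun t : ℝ => (t : ℂ) * c) c t := by
        simpa using (hasDerivAt_id t).ofReal_comp.mul_const c
      exact (e1.sub e2).sub e3
    -- The increment of `L₂ (k + t) - L₁ (k' + t)` over `[0, s]` is within `s ‖c‖ / 2` of `s c ≠ 0`.
    have hmv := Convex.norm_image_sub_le_of_norm_hasDerivWithin_le (s := Set.Icc 0 s)
      (C := ‖c‖ / 2) (x := 0) (y := s) (fun t _ => (hF t).hasDerivWithinAt) (fun t ht => by
        have := hball (x := (k + t, k' + t)) (by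
          rw [Prod.dist_eq, max_lt_iff, Real.dist_eq, Real.dist_eq, abs_lt, abs_lt]
          have h3 := ht.1
          have h4 := ht.2
          constructor <;> constructor <;> simp only <;> linarith [hk.1, hk.2, hk'.1, hk'.2])
        rw [dist_eq_norm] at this
        exact this.le) (convex_Icc 0 s) ⟨le_rfl, hs0.le⟩ ⟨hs0.le, le_rfl⟩
    rw [heq] at hmv
    simp only [add_zero, he, sub_self, zero_sub, ofReal_zero, zero_mul, sub_zero, norm_neg,
      norm_mul, Complex.norm_real] at hmv
    have hpos : 0 < ‖c‖ * ‖s‖ := mul_pos (norm_pos_iff.2 hc) (norm_pos_iff.2 hs0.ne')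
    linarith [mul_comm ‖s‖ ‖c‖]
  · have hcont : ContinuousAt (fun p : ℝ × ℝ => L₂ p.1 - L₁ p.2) (a, b) :=
      ContinuousAt.fun_sub
        (ContinuousAt.comp (x := (a, b)) (f := Prod.fst) (h₂ a).continuousAt continuousAt_fst)
        (ContinuousAt.comp (x := (a, b)) (f := Prod.snd) (h₁ b).continuousAt continuousAt_snd)
    obtain ⟨ε, hε, hball⟩ := Metric.eventually_nhds_iff_ball.1
      (hcont.eventually_ne (sub_ne_zero.2 hval))
    refine ⟨ε / 2, by linarith, fun k hk k' hk' he => ?_⟩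
    refine absurd (sub_eq_zero.2 he) (hball (k, k') ?_)
    rw [Metric.mem_closedBall] at hk hk'
    rw [Metric.mem_ball, Prod.dist_eq, max_lt_iff]
    constructor <;> simp only <;> linarith

/-! ### The dichotomy between vanishing and shifts, and local operators -/

lemma length_pos (r : ℝ) [hr : Fact (0 < r)] : 0 < 2 * Real.pi * r⁻¹ :=
  mul_pos Real.two_pi_pos (inv_pos.2 hr.out)

lemma coe_half_length_ne_zero (r : ℝ) [Fact (0 < r)] :
    ((2 * Real.pi * r⁻¹ / 2 : ℝ) : Torus r) ≠ 0 := by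
  intro hp
  have hl := length_pos r
  rw [AddCircle.coe_eq_zero_iff] at hp
  obtain ⟨n, hn⟩ := hp
  rw [zsmul_eq_mul] at hn
  have h1 : (2 * n - 1 : ℝ) = 0 := by
    have : (2 * n - 1 : ℝ) * (2 * Real.pi * r⁻¹) = 0 := by linarith
    exact (mul_eq_zero.1 this).resolve_right hl.ne'
  have h2 : (2 * n - 1 : ℤ) = 0 := by exact_mod_cast h1
  omega

/-- Nontriviality makes the Haar measure of the torus vanish on points. -/
instance nontrivial_torus : Nontrivial (Torus r) := ⟨_, 0, coe_half_length_ne_zero r⟩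

/-- A map without period is not constant, so its derivative does not vanish identically. -/
lemma HasNoPeriod.exists_deriv_ne_zero {lam : C(Torus r, Circle)} (h : HasNoPeriod lam)
    (han : IsAnalytic lam) : ∃ t, deriv (fun t : ℝ => (lam (t : Torus r) : ℂ)) t ≠ 0 := by
  by_contra! h0
  have hconst := is_const_of_deriv_eq_zero (fun t => (han t).differentiableAt) h0
  refine coe_half_length_ne_zero r (h _ fun k => ?_)
  induction k using QuotientAddGroup.induction_on with
  | H k => exact Subtype.ext (hconst (k + 2 * Real.pi * r⁻¹ / 2) k)

/-- A uniform intertwiner vanishes near every pair of parameters at which the values or the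
derivatives of `λ₁` and `λ₂` differ. -/
lemma Intertwines.exists_nhds_vanishes {lam₁ : C(Torus r₁, Circle)} {lam₂ : C(Torus r₂, Circle)}
    (han₁ : IsAnalytic lam₁) (han₂ : IsAnalytic lam₂)
    {V : LTwo r₁ →L[ℂ] LTwo r₂} (h : Intertwines (toComplex lam₁) (toComplex lam₂) V)
    (hu : UniformOp V) {a b : ℝ} (hab : (lam₂ (a : Torus r₂) : ℂ) = lam₁ (b : Torus r₁) →
      deriv (fun t : ℝ => (lam₂ (t : Torus r₂) : ℂ)) a ≠
        deriv (fun t : ℝ => (lam₁ (t : Torus r₁) : ℂ)) b) :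
    ∃ U ∈ 𝓝 (a : Torus r₂), ∃ U' ∈ 𝓝 (b : Torus r₁), Vanishes V U U' := by
  obtain ⟨δ, hδ, hne⟩ := exists_forall_ne_of_nonresonant han₁ han₂ hab
  have hcl : ∀ {r : ℝ} (a : ℝ),
      IsClosed ((fun t : ℝ => (t : Torus r)) '' Metric.closedBall a δ) := fun a =>
    ((isCompact_closedBall a δ).image (AddCircle.continuous_mk' _)).isClosed
  have hnh : ∀ {r : ℝ} (a : ℝ),
      (fun t : ℝ => (t : Torus r)) '' Metric.closedBall a δ ∈ 𝓝 (a : Torus r) := fun a =>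
    QuotientAddGroup.isOpenMap_coe.image_mem_nhds (Metric.closedBall_mem_nhds a hδ)
  refine ⟨_, hnh a, _, hnh b, vanishes_of_suppIn fun ξ hξ =>
    h.ae_eq_zero hu (hcl a) (hcl b) ?_ hξ⟩
  have hev : ∀ᶠ s : ℝ in 𝓝[>] 0, 0 < s ∧ s < δ :=
    Filter.Eventually.and self_mem_nhdsWithin
      (mem_nhdsWithin_of_mem_nhds (Iio_mem_nhds hδ))
  refine Frequently.filter_mono (Eventually.frequently ?_) (nhdsWithin_le_nhds (s := Set.Ioi 0))
  filter_upwards [hev] with s hs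
  rintro _ ⟨k, hk, rfl⟩ _ ⟨k', hk', rfl⟩ he he'
  refine hne k hk k' hk' (congrArg _ he) s hs.1 hs.2 (congrArg (fun w : Circle => (w : ℂ)) he')

/-- A uniform intertwiner can be nonzero from `I` to `J` only if `λ₂` is a shift of `λ₁` which
relates a point of `J` to a point of `I`. -/
theorem Intertwines.vanishes_or_shift {lam₁ : C(Torus r₁, Circle)} {lam₂ : C(Torus r₂, Circle)}
    (han₁ : IsAnalytic lam₁) (han₂ : IsAnalytic lam₂) (hper₁ : HasNoPeriod lam₁)
    {V : LTwo r₁ →L[ℂ] LTwo r₂} (h : Intertwines (toComplex lam₁) (toComplex lam₂) V)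
    (hu : UniformOp V) {J : Set (Torus r₂)} {I : Set (Torus r₁)} (hJ : IsClosed J)
    (hI : IsClosed I) :
    Vanishes V J I ∨ ∃ a b : ℝ, (a : Torus r₂) ∈ J ∧ (b : Torus r₁) ∈ I ∧
      ∀ t : ℝ, lam₂ (t : Torus r₂) = lam₁ ((t + (b - a) : ℝ) : Torus r₁) := by
  set L₁ : ℝ → ℂ := fun t => (lam₁ (t : Torus r₁) : ℂ) with hL₁
  set L₂ : ℝ → ℂ := fun t => (lam₂ (t : Torus r₂) : ℂ) with hL₂
  -- The pairs of parameters, in `J × I`, near which `V` need not vanish.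
  let S : Set (ℝ × ℝ) := {p | ((p.1 : Torus r₂) ∈ J ∧ (p.2 : Torus r₁) ∈ I) ∧
    L₂ p.1 = L₁ p.2 ∧ deriv L₂ p.1 = deriv L₁ p.2}
  have hS : IsClosed S := by
    have c₁ : Continuous L₁ := continuous_iff_continuousAt.2 fun t => (han₁ t).continuousAt
    have c₂ : Continuous L₂ := continuous_iff_continuousAt.2 fun t => (han₂ t).continuousAt
    have d₁ : Continuous (deriv L₁) :=
      continuous_iff_continuousAt.2 fun t => (han₁ t).deriv.continuousAt
    have d₂ : Continuous (deriv L₂) :=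
      continuous_iff_continuousAt.2 fun t => (han₂ t).deriv.continuousAt
    refine ((hJ.preimage ?_).inter (hI.preimage ?_)).inter
      ((isClosed_eq (c₂.comp continuous_fst) (c₁.comp continuous_snd)).inter
        (isClosed_eq (d₂.comp continuous_fst) (d₁.comp continuous_snd)))
    · exact (AddCircle.continuous_mk' _).comp continuous_fst
    · exact (AddCircle.continuous_mk' _).comp continuous_snd
  by_cases hc : {k' ∈ Set.Icc 0 (2 * Real.pi * r₁⁻¹) |
      ∃ k ∈ Set.Icc 0 (2 * Real.pi * r₂⁻¹), (k, k') ∈ S}.Countable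
  · left
    have hrep : ∀ {r : ℝ} [Fact (0 < r)] (k : Torus r),
        ∃ t ∈ Set.Icc 0 (2 * Real.pi * r⁻¹), (t : Torus r) = k := by
      intro r _ k
      have hk : k ∈ ((↑) : ℝ → Torus r) '' Set.Icc 0 (0 + 2 * Real.pi * r⁻¹) := by
        rw [AddCircle.coe_image_Icc_eq]
        trivial
      rwa [zero_add] at hk
    refine vanishes_of_locally hJ ((hc.image fun t : ℝ => (t : Torus r₁)).measure_zero _) ?_
    intro k hk k' hk' hk'N
    obtain ⟨a, ha, rfl⟩ := hrep k
    obtain ⟨b, hb, rfl⟩ := hrep k'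
    refine h.exists_nhds_vanishes han₁ han₂ hu fun hval hder => hk'N ?_
    exact ⟨b, ⟨hb, a, ha, ⟨hk, hk'⟩, hval, hder⟩, rfl⟩
  · right
    obtain ⟨p, hp, hsh⟩ := exists_shift_of_not_countable (L₁ := L₁) (L₂ := L₂) han₁ han₂
      (fun t => Circle.norm_coe _) (fun t => Circle.norm_coe _) (hper₁.exists_deriv_ne_zero han₁)
      hS (fun p hp => hp.2.1) (fun p hp => hp.2.2) isCompact_Icc hc
    exact ⟨p.1, p.2, hp.1.1, hp.1.2, fun t => Subtype.ext (hsh t)⟩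

/-- If `λ₂` is a shift of `λ₁`, then the length of the second torus is a period of `λ₁`, hence a
positive multiple of the length of the first one. -/
lemma HasNoPeriod.length_le {lam₁ : C(Torus r₁, Circle)} {lam₂ : C(Torus r₂, Circle)}
    (hper₁ : HasNoPeriod lam₁) {c : ℝ}
    (h : ∀ t : ℝ, lam₂ (t : Torus r₂) = lam₁ ((t + c : ℝ) : Torus r₁)) :
    2 * Real.pi * r₁⁻¹ ≤ 2 * Real.pi * r₂⁻¹ := by
  have hp := hper₁ ((2 * Real.pi * r₂⁻¹ : ℝ) : Torus r₁) fun k => by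
    induction k using QuotientAddGroup.induction_on with
    | H k =>
      have h1 := h (k - c + 2 * Real.pi * r₂⁻¹)
      have h2 := h (k - c)
      rw [AddCircle.coe_add_period, h2] at h1
      rw [sub_add_cancel, show k - c + 2 * Real.pi * r₂⁻¹ + c = k + 2 * Real.pi * r₂⁻¹ by ring]
        at h1
      exact h1.symm
  rw [AddCircle.coe_eq_zero_iff] at hp
  obtain ⟨n, hn⟩ := hp
  rw [zsmul_eq_mul] at hn
  have h1 := length_pos r₁
  have h2 := length_pos r₂
  have hn0 : (0 : ℝ) < n := by
    by_contra hneg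
    have := mul_nonpos_of_nonpos_of_nonneg (not_lt.1 hneg) h1.le
    linarith
  have hn1 : (1 : ℝ) ≤ n := by exact_mod_cast (by exact_mod_cast hn0 : (0 : ℤ) < n)
  nlinarith

/-- Functions without period which are shifts of each other live on tori of the same length. -/
lemma eq_of_shift {lam₁ : C(Torus r₁, Circle)} {lam₂ : C(Torus r₂, Circle)}
    (hper₁ : HasNoPeriod lam₁) (hper₂ : HasNoPeriod lam₂) {c : ℝ}
    (h : ∀ t : ℝ, lam₂ (t : Torus r₂) = lam₁ ((t + c : ℝ) : Torus r₁)) : r₂ = r₁ := by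
  have h1 := hper₁.length_le h
  have h2 := hper₂.length_le (lam₂ := lam₁) (c := -c) fun t => by
    rw [h, neg_add_cancel_right]
  exact inv_injective (mul_left_cancel₀ Real.two_pi_pos.ne' (le_antisymm h2 h1))

/-- `W` does not relate disjoint closed sets, i.e. `W` does not enlarge supports. -/
def IsLocal (W : LTwo r →L[ℂ] LTwo r) : Prop :=
  ∀ J I : Set (Torus r), IsClosed J → IsClosed I → Disjoint J I → Vanishes W J I

lemma IsLocal.adjoint {W : LTwo r →L[ℂ] LTwo r} (h : IsLocal W) :
    IsLocal (ContinuousLinearMap.adjoint W) :=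
  fun J I hJ hI hd => (h I J hI hJ hd.symm).adjoint

/-- A local operator maps functions supported in a closed set to functions supported there. -/
lemma IsLocal.vanishes_compl {W : LTwo r →L[ℂ] LTwo r} (h : IsLocal W) {C : Set (Torus r)}
    (hC : IsClosed C) : Vanishes W Cᶜ C := by
  obtain ⟨F, hF, hFC, hFU, -⟩ := hC.isOpen_compl.exists_iUnion_isClosed
  refine vanishes_of_suppIn fun ξ hξ => ?_
  have h1 : ∀ n, SuppIn (W ξ) (F n)ᶜ := fun n =>
    (h (F n) C (hF n) hC (Set.disjoint_left.2 fun k hk => hFC n hk)).suppIn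
      (hF n).measurableSet hξ
  filter_upwards [ae_all_iff.2 h1] with k hk hkC
  have hkU : k ∈ ⋃ n, F n := by
    rw [hFU]
    exact not_not.1 hkC
  obtain ⟨n, hn⟩ := Set.mem_iUnion.1 hkU
  exact hk n (not_not.2 hn)

lemma inner_cutoff_right {C : Set (Torus r)} (hC : MeasurableSet C) (ξ η : LTwo r) :
    inner ℂ η (cutoff C hC ξ) = ∫ k in C, inner ℂ (η k) (ξ k) ∂AddCircle.haarAddCircle := by
  rw [L2.inner_def, ← integral_indicator hC]
  refine integral_congr_ae ?_
  filter_upwards [cutoff_ae C hC ξ] with k hk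
  rw [hk]
  by_cases hkC : k ∈ C
  · rw [Set.indicator_of_mem hkC, Set.indicator_of_mem hkC]
  · rw [Set.indicator_of_notMem hkC, Set.indicator_of_notMem hkC, inner_zero_right]

lemma inner_cutoff_left {C : Set (Torus r)} (hC : MeasurableSet C) (ξ η : LTwo r) :
    inner ℂ (cutoff C hC η) ξ = ∫ k in C, inner ℂ (η k) (ξ k) ∂AddCircle.haarAddCircle := by
  rw [L2.inner_def, ← integral_indicator hC]
  refine integral_congr_ae ?_
  filter_upwards [cutoff_ae C hC η] with k hk
  rw [hk]
  by_cases hkC : k ∈ C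
  · rw [Set.indicator_of_mem hkC, Set.indicator_of_mem hkC]
  · rw [Set.indicator_of_notMem hkC, Set.indicator_of_notMem hkC, inner_zero_left]

lemma cutoff_add_cutoff_compl {C : Set (Torus r)} (hC : MeasurableSet C) (ξ : LTwo r) :
    cutoff C hC ξ + cutoff Cᶜ hC.compl ξ = ξ := by
  apply Lp.ext
  filter_upwards [Lp.coeFn_add (cutoff C hC ξ) (cutoff Cᶜ hC.compl ξ), cutoff_ae C hC ξ,
    cutoff_ae Cᶜ hC.compl ξ] with k h1 h2 h3
  rw [h1, Pi.add_apply, h2, h3, Set.indicator_self_add_compl_apply]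

/-- A local operator is multiplication by a function, namely by the conjugate of `W† 1`. In
particular it commutes with all multiplication operators. -/
theorem IsLocal.comm_mulOp {W : LTwo r →L[ℂ] LTwo r} (h : IsLocal W) (g : C(Torus r, ℂ)) :
    Intertwines g g W := by
  set e : LTwo r := ContinuousMap.toLp 2 AddCircle.haarAddCircle ℂ 1 with he
  -- Both sides have the same integral over every closed set `C`, as `W` and `W†` preserve
  -- supports in `C`, so that `W` commutes with the restriction to `C`.
  have hmul : ∀ ξ : LTwo r, (fun k => inner ℂ (ContinuousLinearMap.adjoint W e k) (ξ k))
      =ᵐ[AddCircle.haarAddCircle] W ξ := by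
    intro ξ
    have hint₁ := L2.integrable_inner (𝕜 := ℂ) (ContinuousLinearMap.adjoint W e) ξ
    have hint₂ := L2.integrable_inner (𝕜 := ℂ) e (W ξ)
    have hcl : ∀ C : Set (Torus r), IsClosed C →
        ∫ k in C, inner ℂ (ContinuousLinearMap.adjoint W e k) (ξ k) - inner ℂ (e k) (W ξ k)
          ∂AddCircle.haarAddCircle = 0 := by
      intro C hC
      have hCm := hC.measurableSet
      rw [integral_sub hint₁.integrableOn hint₂.integrableOn, ← inner_cutoff_right hCm,
        ← inner_cutoff_left hCm, ContinuousLinearMap.adjoint_inner_left, sub_eq_zero]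
      have v₁ : inner ℂ (cutoff Cᶜ hCm.compl e) (W (cutoff C hCm ξ)) = 0 :=
        h.vanishes_compl hC _ _ (suppIn_cutoff _ _ _) (suppIn_cutoff _ _ _)
      have v₂ : inner ℂ (cutoff C hCm e) (W (cutoff Cᶜ hCm.compl ξ)) = 0 :=
        vanishes_adjoint.1 (h.adjoint.vanishes_compl hC) _ _ (suppIn_cutoff _ _ _)
          (suppIn_cutoff _ _ _)
      calc inner ℂ e (W (cutoff C hCm ξ))
          = inner ℂ (cutoff C hCm e + cutoff Cᶜ hCm.compl e) (W (cutoff C hCm ξ)) := by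
            rw [cutoff_add_cutoff_compl]
        _ = inner ℂ (cutoff C hCm e) (W (cutoff C hCm ξ + cutoff Cᶜ hCm.compl ξ)) := by
            rw [inner_add_left, v₁, map_add, inner_add_right, v₂]
        _ = inner ℂ (cutoff C hCm e) (W ξ) := by rw [cutoff_add_cutoff_compl]
    have h0 := ae_eq_zero_of_forall_setIntegral_isClosed_eq_zero (hint₁.sub hint₂) hcl
    filter_upwards [h0, ContinuousMap.coeFn_toLp (p := 2) (𝕜 := ℂ) AddCircle.haarAddCircle
      (1 : C(Torus r, ℂ))] with k hk hek
    rw [← he] at hek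
    have h3 : inner ℂ (ContinuousLinearMap.adjoint W e k) (ξ k) = inner ℂ (e k) (W ξ k) :=
      sub_eq_zero.1 hk
    rw [h3, hek]
    simp
  intro ξ
  apply Lp.ext
  filter_upwards [hmul (mulOp r g ξ), hmul ξ, mulOp_ae r g ξ, mulOp_ae r g (W ξ)]
    with k h1 h2 h3 h4
  rw [← h1, h4, ← h2, h3]
  exact inner_smul_right (𝕜 := ℂ) _ (ξ k) (g k)

/-- Uniform operators commuting with multiplication by an analytic function without period
are local. -/
lemma Intertwines.isLocal {lam : C(Torus r, Circle)} (han : IsAnalytic lam)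
    (hper : HasNoPeriod lam) {W : LTwo r →L[ℂ] LTwo r}
    (h : Intertwines (toComplex lam) (toComplex lam) W) (hu : UniformOp W) : IsLocal W := by
  intro J I hJ hI hd
  refine (h.vanishes_or_shift han han hper hu hJ hI).resolve_right ?_
  rintro ⟨a, b, ha, hb, hsh⟩
  have hp := hper ((b - a : ℝ) : Torus r) fun k => by
    induction k using QuotientAddGroup.induction_on with
    | H k => exact (hsh k).symm
  rw [AddCircle.coe_sub, sub_eq_zero] at hp
  exact Set.disjoint_left.1 hd ha (hp ▸ hb)

/-! ### Uniform operators commuting with multiplications -/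

/-- Together with `‖M[g]‖ ≤ ‖g‖` this says that `g ↦ M[g]` is isometric; test functions are
indicators of sets where `|g|` is large. -/
lemma norm_le_norm_mulOp (g : C(Torus r, ℂ)) : ‖g‖ ≤ ‖mulOp r g‖ := by
  refine (ContinuousMap.norm_le g (norm_nonneg _)).2 fun x => ?_
  by_contra! hlt
  obtain ⟨c, hc₁, hc₂⟩ := exists_between hlt
  have hc0 : 0 ≤ c := (norm_nonneg _).trans hc₁.le
  let U : Set (Torus r) := {k | c < ‖g k‖}
  have hU : IsOpen U := isOpen_lt continuous_const g.continuous.norm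
  set e : LTwo r := ContinuousMap.toLp 2 AddCircle.haarAddCircle ℂ 1
  set ξ := cutoff U hU.measurableSet e with hξ_def
  have hξ : ξ ≠ 0 := by
    intro h0
    have hpos := hU.measure_pos (AddCircle.haarAddCircle : Measure (Torus r)) ⟨x, hc₂⟩
    refine hpos.ne' (measure_eq_zero_iff_ae_notMem.2 ?_)
    have hcut := cutoff_ae U hU.measurableSet e
    rw [← hξ_def, h0] at hcut
    filter_upwards [hcut, Lp.coeFn_zero ℂ 2 (AddCircle.haarAddCircle : Measure (Torus r)),
      ContinuousMap.coeFn_toLp (p := 2) (𝕜 := ℂ) AddCircle.haarAddCircle (1 : C(Torus r, ℂ))]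
      with k h1 h2 h3 hkU
    rw [h2, Set.indicator_of_mem hkU, h3] at h1
    simp at h1
  have hle : ‖(c : ℂ) • ξ‖ ≤ ‖mulOp r g ξ‖ := by
    refine Lp.norm_le_norm_of_ae_le ?_
    filter_upwards [mulOp_ae r g ξ, Lp.coeFn_smul (c : ℂ) ξ,
      suppIn_cutoff U hU.measurableSet e] with k h1 h2 h3
    rw [h1, h2, Pi.smul_apply, norm_smul, norm_mul, Complex.norm_real, Real.norm_of_nonneg hc0]
    by_cases hkU : k ∈ U
    · exact mul_le_mul_of_nonneg_right (le_of_lt hkU) (norm_nonneg _)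
    · rw [h3 hkU]
      simp
  rw [norm_smul, Complex.norm_real, Real.norm_of_nonneg hc0] at hle
  have h4 := hle.trans ((mulOp r g).le_opNorm ξ)
  exact absurd (le_of_mul_le_mul_right h4 (norm_pos_iff.2 hξ)) (not_le.2 hc₁)

lemma isClosed_range_mulOp : IsClosed (LinearMap.range (mulOpL r).toLinearMap :
    Set (LTwo r →L[ℂ] LTwo r)) := by
  have h : AntilipschitzWith 1 (mulOpL r) :=
    (mulOpL r).antilipschitz_of_bound fun g => by
      rw [NNReal.coe_one, one_mul]
      exact norm_le_norm_mulOp g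
  exact h.isClosed_range (mulOpL r).uniformContinuous

/-- Hahn–Banach: a vector outside a closed subspace is detected by a functional vanishing on
the subspace. -/
lemma exists_functional_of_notMem {E : Type*} [NormedAddCommGroup E] [NormedSpace ℂ E]
    (R : Submodule ℂ E) (hR : IsClosed (R : Set E)) {x : E} (hx : x ∉ R) :
    ∃ f : E →L[ℂ] ℂ, (∀ a ∈ R, f a = 0) ∧ f x ≠ 0 := by
  obtain ⟨f, u, hfR, hfx⟩ := RCLike.geometric_hahn_banach_closed_point (𝕜 := ℂ)
    (R.restrictScalars ℝ).convex hR hx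
  have hf0 : ∀ a ∈ R, f a = 0 := by
    intro a ha
    by_contra hne
    have h := hfR (((u : ℂ) / f a) • a) (R.smul_mem _ ha)
    rw [map_smul, smul_eq_mul, div_mul_cancel₀ _ hne] at h
    exact lt_irrefl _ h
  refine ⟨f, hf0, fun h0 => ?_⟩
  have h1 := hfR 0 R.zero_mem
  rw [map_zero] at h1
  rw [h0] at hfx
  exact lt_asymm h1 hfx

lemma inner_characterLp (y : Lattice r) (ξ : LTwo r) :
    inner ℂ (characterLp r y) ξ = fourierTransform r ξ y := by
  have h := (HilbertBasis.mk (orthonormal_characterLp r) (span_characterLp r)).repr_apply_apply ξ y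
  rw [HilbertBasis.coe_mk] at h
  exact h.symm

lemma eq_of_inner_characterLp {ξ η : LTwo r}
    (h : ∀ y, inner ℂ (characterLp r y) ξ = inner ℂ (characterLp r y) η) : ξ = η := by
  apply (fourierTransform r).injective
  ext y
  rw [← inner_characterLp, ← inner_characterLp, h]

lemma inner_characterLp_translate (y : Lattice r) (s : ℝ) (ξ : LTwo r) :
    inner ℂ (characterLp r y) (translate r s ξ) =
      cexp (I * s * (y : ℝ)) * inner ℂ (characterLp r y) ξ := by
  rw [inner_characterLp, inner_characterLp, translate_apply, LinearIsometryEquiv.apply_symm_apply,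
    expPosition_apply]

lemma inner_characterLp_mulOp (x y : Lattice r) (ξ : LTwo r) :
    inner ℂ (characterLp r y) (mulOp r (character r x) ξ) =
      inner ℂ (characterLp r (y - x)) ξ := by
  classical
  suffices (innerSL ℂ (characterLp r y)) ∘L mulOp r (character r x) =
      innerSL ℂ (characterLp r (y - x)) from congrArg (fun A => A ξ) this
  refine clm_ext_characterLp fun z => ?_
  rw [ContinuousLinearMap.comp_apply, mulOp_characterLp, innerSL_apply_apply, innerSL_apply_apply,
    orthonormal_iff_ite.1 (orthonormal_characterLp r), orthonormal_iff_ite.1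
      (orthonormal_characterLp r)]
  simp only [sub_eq_iff_eq_add, add_comm]

/-- The matrix of an operator commuting with multiplication operators is constant along diagonals,
and conjugation by translations multiplies the diagonals by characters. -/
lemma inner_conjTranslate_characterLp {W : LTwo r →L[ℂ] LTwo r}
    (hW : ∀ g, Intertwines g g W) (x y : Lattice r) (s : ℝ) :
    inner ℂ (characterLp r y) (conjTranslate W s (characterLp r x)) =
      character r (y - x) (s : Torus r) *
        inner ℂ (characterLp r (y - x)) (W (characterLp r 0)) := by
  have hx : characterLp r x = mulOp r (character r x) (characterLp r 0) := by
    rw [mulOp_characterLp, add_zero]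
  rw [conjTranslate_apply, inner_characterLp_translate, translate_characterLp, map_smul,
    inner_smul_right, ← mul_assoc, ← Complex.exp_add, hx, hW, inner_characterLp_mulOp,
    character_coe]
  congr 2
  push_cast
  ring

lemma translate_add_length (s : ℝ) :
    translate r (s + 2 * Real.pi * r⁻¹) = translate r s := by
  refine clm_ext_characterLp fun x => ?_
  rw [translate_characterLp, translate_characterLp]
  have h := exp_periodic x s
  simp only at h
  rw [show I * ((s + 2 * Real.pi * r⁻¹ : ℝ) : ℂ) * (x : ℝ) =
    I * (x : ℝ) * ((s + 2 * Real.pi * r⁻¹ : ℝ) : ℂ) by ring, h,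
    show I * ((x : ℝ) : ℂ) * (s : ℂ) = I * s * (x : ℝ) by ring]

lemma conjTranslate_periodic (W : LTwo r →L[ℂ] LTwo r) :
    Function.Periodic (conjTranslate W) (2 * Real.pi * r⁻¹) := by
  intro s
  have h := translate_add_length (r := r) (-(s + 2 * Real.pi * r⁻¹))
  rw [neg_add, neg_add_cancel_right, ← neg_add] at h
  rw [conjTranslate, conjTranslate, translate_add_length, ← h]

/-- The Fourier coefficients of `s ↦ T_s W T_{-s}` are multiples of multiplications by
characters. -/
lemma integral_conjTranslate {W : LTwo r →L[ℂ] LTwo r} (hW : ∀ g, Intertwines g g W)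
    (hu : UniformOp W) (n : ℤ) :
    ∃ c : ℂ, ∫ s in (0 : ℝ)..(0 + 2 * Real.pi * r⁻¹),
      fourier (T := 2 * Real.pi * r⁻¹) (-n) (s : Torus r) • conjTranslate W s =
        mulOp r (c • fourier n) := by
  classical
  let z : Lattice r := ⟨n • r, n, rfl⟩
  let w : Lattice r → ℂ := fun y => inner ℂ (characterLp r y) (W (characterLp r 0))
  have hcont : Continuous fun s : ℝ =>
      fourier (T := 2 * Real.pi * r⁻¹) (-n) (s : Torus r) • conjTranslate W s :=
    ((fourier (-n)).continuous.comp (AddCircle.continuous_mk' _)).smul hu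
  refine ⟨(2 * Real.pi * r⁻¹ : ℝ) * w z, clm_ext_characterLp fun x =>
    eq_of_inner_characterLp fun y => ?_⟩
  let Φ : (LTwo r →L[ℂ] LTwo r) →L[ℂ] ℂ :=
    (innerSL ℂ (characterLp r y)) ∘L (ContinuousLinearMap.apply ℂ (LTwo r) (characterLp r x))
  have hΦ_apply : ∀ A : LTwo r →L[ℂ] LTwo r,
      inner ℂ (characterLp r y) (A (characterLp r x)) = Φ A := fun _ => rfl
  rw [hΦ_apply, ← Φ.intervalIntegral_comp_comm (hcont.intervalIntegrable _ _)]
  have hΦ : ∀ s : ℝ, Φ (fourier (T := 2 * Real.pi * r⁻¹) (-n) (s : Torus r) • conjTranslate W s) =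
      (fourier (T := 2 * Real.pi * r⁻¹) (-n) (s : Torus r) • character r (y - x) (s : Torus r)) *
        w (y - x) := by
    intro s
    rw [map_smul, smul_eq_mul, smul_eq_mul]
    refine Eq.trans ?_ (mul_assoc _ _ _).symm
    exact congrArg _ (inner_conjTranslate_characterLp hW x y s)
  simp only [hΦ]
  rw [intervalIntegral.integral_mul_const]
  have hfc := fourierCoeff_eq_intervalIntegral (character r (y - x)) n 0
  have hl := length_pos r
  rw [eq_comm, one_div, inv_smul_eq_iff₀ hl.ne'] at hfc
  rw [hfc, ← mulOpL_apply, map_smul, mulOpL_apply, ← character_zsmul, _root_.smul_apply,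
    mulOp_characterLp, inner_smul_right, orthonormal_iff_ite.1 (orthonormal_characterLp r)]
  obtain ⟨m, hm⟩ : ∃ m : ℤ, y - x = ⟨m • r, m, rfl⟩ := by
    obtain ⟨_, m, hm⟩ := y - x
    exact ⟨m, Subtype.ext hm.symm⟩
  -- On both sides only the entries with `y - x = n r` are nonzero.
  have hzm : y = z + x ↔ n = m := by
    rw [← sub_eq_iff_eq_add, hm]
    refine ⟨fun h => ?_, fun h => by rw [← h]⟩
    have h1 : m • r = n • r := congrArg Subtype.val h
    rw [zsmul_eq_mul, zsmul_eq_mul] at h1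
    exact_mod_cast (mul_right_cancel₀ hr.out.ne' h1).symm
  rw [hm, character_zsmul, fourierCoeff_fourier, Pi.single_apply]
  by_cases hnm : n = m
  · subst hnm
    rw [if_pos rfl, if_pos (hzm.2 rfl), Complex.real_smul]
    ring
  · rw [if_neg hnm, if_neg fun h => hnm (hzm.1 h)]
    simp

/-- A uniform operator commuting with all multiplication operators is multiplication by
a continuous function. -/
theorem UniformOp.exists_eq_mulOp {W : LTwo r →L[ℂ] LTwo r} (hu : UniformOp W)
    (hW : ∀ g, Intertwines g g W) : ∃ ρ : C(Torus r, ℂ), W = mulOp r ρ := by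
  by_contra! hne
  obtain ⟨f, hf0, hfW⟩ := exists_functional_of_notMem _ (isClosed_range_mulOp (r := r))
    (x := W) (by rintro ⟨ρ, hρ⟩; exact hne ρ hρ.symm)
  -- The continuous function `s ↦ f(T_s W T_{-s})` has vanishing Fourier coefficients.
  have hper : Function.Periodic (fun s => f (conjTranslate W s)) (2 * Real.pi * r⁻¹) :=
    fun s => congrArg f (conjTranslate_periodic W s)
  let ψ : C(Torus r, ℂ) := ⟨hper.lift, continuous_coinduced_dom.2 (f.continuous.comp hu)⟩
  have hψ : fourierCoeff ψ = 0 := by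
    ext n
    obtain ⟨c, hc⟩ := integral_conjTranslate hW hu n
    have hcont : Continuous fun s : ℝ =>
        fourier (T := 2 * Real.pi * r⁻¹) (-n) (s : Torus r) • conjTranslate W s :=
      ((fourier (-n)).continuous.comp (AddCircle.continuous_mk' _)).smul hu
    have hi : ∀ s : ℝ, fourier (T := 2 * Real.pi * r⁻¹) (-n) (s : Torus r) • ψ (s : Torus r) =
        f (fourier (T := 2 * Real.pi * r⁻¹) (-n) (s : Torus r) • conjTranslate W s) := by
      intro s
      rw [map_smul]
      rfl
    rw [fourierCoeff_eq_intervalIntegral ψ n 0]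
    simp only [hi]
    rw [f.intervalIntegral_comp_comm (hcont.intervalIntegrable _ _), hc, hf0 (mulOp r
      (c • fourier n)) ⟨_, rfl⟩,
      smul_zero]
    rfl
  have hsum := has_pointwise_sum_fourier_series_of_summable (f := ψ)
    (by rw [hψ]; exact summable_zero) ((0 : ℝ) : Torus r)
  rw [hψ] at hsum
  simp only [Pi.zero_apply, zero_smul] at hsum
  have h0 : f (conjTranslate W 0) = 0 := hsum.unique hasSum_zero
  rw [conjTranslate_zero] at h0
  exact hfW h0

lemma continuous_comp_rotation {r : ℝ} (ρ : C(Torus r, ℂ)) :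
    Continuous fun s : ℝ => ρ.comp (rotation r s) := by
  refine ContinuousMap.continuous_of_continuous_uncurry _ ?_
  exact ρ.continuous.comp (continuous_snd.add ((AddCircle.continuous_mk' _).comp continuous_fst))

lemma conjTranslate_comp_translate (W : LTwo r₁ →L[ℂ] LTwo r₂) (a s : ℝ) :
    conjTranslate (W ∘L translate r₁ a) s = conjTranslate W s ∘L translate r₁ a := by
  ext1 ξ
  simp only [conjTranslate_apply, ContinuousLinearMap.comp_apply, ← translate_add_apply]
  rw [add_comm]

lemma UniformOp.comp_translate {W : LTwo r₁ →L[ℂ] LTwo r₂} (hu : UniformOp W) (a : ℝ) :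
    UniformOp (W ∘L translate r₁ a) := by
  have h : conjTranslate (W ∘L translate r₁ a) = fun s => conjTranslate W s ∘L translate r₁ a :=
    funext fun s => conjTranslate_comp_translate W a s
  rw [UniformOp, h]
  exact Continuous.clm_comp hu continuous_const

lemma uniformOp_mulOp (ρ : C(Torus r, ℂ)) : UniformOp (mulOp r ρ) := by
  have h : conjTranslate (mulOp r ρ) = fun s => mulOp r (ρ.comp (rotation r s)) := by
    ext1 s
    ext1 ξ
    rw [conjTranslate_apply, translate_mulOp_apply, translate_neg_apply]
  rw [UniformOp, h]
  exact (continuous_mulOp r).comp (continuous_comp_rotation ρ)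

/-- The operator `F_{r₂}⁻¹ V F_{r₁}` between `L²` spaces. -/
def pullback (V : EllTwo r₁ →L[ℂ] EllTwo r₂) : LTwo r₁ →L[ℂ] LTwo r₂ :=
  ((fourierTransform r₂).symm.toContinuousLinearEquiv : EllTwo r₂ →L[ℂ] LTwo r₂) ∘L V ∘L
    ((fourierTransform r₁).toContinuousLinearEquiv : LTwo r₁ →L[ℂ] EllTwo r₁)

lemma pullback_apply (V : EllTwo r₁ →L[ℂ] EllTwo r₂) (ξ : LTwo r₁) :
    pullback V ξ = (fourierTransform r₂).symm (V (fourierTransform r₁ ξ)) := rfl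

lemma apply_eq_pullback (V : EllTwo r₁ →L[ℂ] EllTwo r₂) (x : EllTwo r₁) :
    V x = fourierTransform r₂ (pullback V ((fourierTransform r₁).symm x)) := by
  simp [pullback_apply]

/-- Passing to `L²` is injective, the Fourier transforms being unitary. -/
lemma pullback_injective :
    Function.Injective (pullback : (EllTwo r₁ →L[ℂ] EllTwo r₂) → (LTwo r₁ →L[ℂ] LTwo r₂)) := by
  intro V V' h
  ext1 x
  rw [apply_eq_pullback V, h, ← apply_eq_pullback]

lemma pullback_fourierMulOp_comp_expPosition (ρ : C(Torus r, ℂ)) (a : ℝ) :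
    pullback (fourierMulOp r ρ ∘L expPosition r a) = mulOp r ρ ∘L translate r a := by
  ext1 ξ
  simp [pullback_apply, translate_apply, fourierMulOp]

/-- Uniform intertwiners, expressed on the `L²` side. -/
lemma isUniformIntertwiner_iff (lam₁ : C(Torus r₁, Circle)) (lam₂ : C(Torus r₂, Circle))
    (V : EllTwo r₁ →L[ℂ] EllTwo r₂) :
    IsUniformIntertwiner lam₁ lam₂ V ↔
      Intertwines (toComplex lam₁) (toComplex lam₂) (pullback V) ∧ UniformOp (pullback V) := by
  have hcoe : ∀ {r : ℝ} [Fact (0 < r)] (g : C(Torus r, ℂ)) (x : EllTwo r),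
      fourierMulOp r g x = fourierTransform r (mulOp r g ((fourierTransform r).symm x)) :=
    fun _ _ => rfl
  refine and_congr ⟨fun h ξ => ?_, fun h => ?_⟩ ⟨fun h => ?_, fun h => ?_⟩
  · have h1 := congrArg (fun A => A (fourierTransform r₁ ξ)) h
    simp only [ContinuousLinearMap.comp_apply, walk, hcoe,
      LinearIsometryEquiv.symm_apply_apply] at h1
    rw [pullback_apply, h1, LinearIsometryEquiv.symm_apply_apply, pullback_apply]
  · ext1 x
    have h1 := h ((fourierTransform r₁).symm x)
    rw [pullback_apply, pullback_apply, LinearIsometryEquiv.symm_apply_eq,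
      LinearIsometryEquiv.apply_symm_apply] at h1
    exact h1
  · have e : conjTranslate (pullback V) =
        fun s => pullback (expPosition r₂ s ∘L V ∘L expPosition r₁ (-s)) := by
      ext1 s
      ext1 ξ
      simp [conjTranslate_apply, pullback_apply, translate_apply]
    rw [UniformOp, e]
    exact continuous_const.clm_comp (Continuous.clm_comp h continuous_const)
  · have e : (fun s => expPosition r₂ s ∘L V ∘L expPosition r₁ (-s)) = fun s =>
        ((fourierTransform r₂).toContinuousLinearEquiv : LTwo r₂ →L[ℂ] EllTwo r₂) ∘L
          conjTranslate (pullback V) s ∘L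
          ((fourierTransform r₁).symm.toContinuousLinearEquiv : EllTwo r₁ →L[ℂ] LTwo r₁) := by
      ext1 s
      ext1 x
      simp [conjTranslate_apply, pullback_apply, translate_apply]
    rw [IsUniform, e]
    exact continuous_const.clm_comp (Continuous.clm_comp h continuous_const)

/-- If `λ₂ = λ₁(· + a)`, then the uniform intertwiners are the operators
`F M[ρ] F⁻¹ exp(i a D)` with `ρ` continuous. -/
theorem isUniformIntertwiner_iff_exists {lam₁ lam₂ : C(Torus r, Circle)} (han₂ : IsAnalytic lam₂)
    (hper₂ : HasNoPeriod lam₂) {a : ℝ} (ha : ∀ k : Torus r, lam₂ k = lam₁ (k + (a : Torus r)))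
    (V : EllTwo r →L[ℂ] EllTwo r) :
    IsUniformIntertwiner lam₁ lam₂ V ↔
      ∃ ρ : C(Torus r, ℂ), V = fourierMulOp r ρ ∘L expPosition r a := by
  have h₂ : (toComplex lam₁).comp (rotation r a) = toComplex lam₂ := by
    ext k
    exact congrArg (fun w : Circle => (w : ℂ)) (ha k).symm
  rw [isUniformIntertwiner_iff]
  constructor
  · rintro ⟨h, hu⟩
    -- Composition with `exp(-i a D)` reduces to the case of operators commuting with `M[λ₂]`.
    have hW : Intertwines (toComplex lam₂) (toComplex lam₂) (pullback V ∘L translate r (-a)) := by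
      intro ξ
      have h₁ : (toComplex lam₂).comp (rotation r (-a)) = toComplex lam₁ := by
        rw [← h₂]
        ext k
        simp
      rw [ContinuousLinearMap.comp_apply, translate_mulOp_apply, h₁, h,
        ContinuousLinearMap.comp_apply]
    have huW := hu.comp_translate (-a)
    obtain ⟨ρ, hρ⟩ := huW.exists_eq_mulOp fun g => (hW.isLocal han₂ hper₂ huW).comm_mulOp g
    refine ⟨ρ, pullback_injective ?_⟩
    rw [pullback_fourierMulOp_comp_expPosition, ← hρ]
    ext1 ξ
    simp
  · rintro ⟨ρ, rfl⟩
    rw [pullback_fourierMulOp_comp_expPosition]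
    refine ⟨fun ξ => ?_, (uniformOp_mulOp ρ).comp_translate a⟩
    rw [ContinuousLinearMap.comp_apply, translate_mulOp_apply, h₂, mulOp_comm_apply,
      ContinuousLinearMap.comp_apply]

end

end ModelWalk

theorem mainTheorem2 (r₁ r₂ : ℝ) [Fact (0 < r₁)] [Fact (0 < r₂)]
    (lam₁ : C(Torus r₁, Circle)) (lam₂ : C(Torus r₂, Circle))
    (han₁ : IsAnalytic lam₁) (han₂ : IsAnalytic lam₂)
    (hper₁ : HasNoPeriod lam₁) (hper₂ : HasNoPeriod lam₂)
    (hV : ∃ V : EllTwo r₁ →L[ℂ] EllTwo r₂, V ≠ 0 ∧ IsUniformIntertwiner lam₁ lam₂ V) :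
    ∃ h : r₂ = r₁,
      (∃! α : Torus r₁, ∀ k : Torus r₁, (h ▸ lam₂ : C(Torus r₁, Circle)) k = lam₁ (k + α)) ∧
      ∀ a : ℝ,
        (∀ k : Torus r₁,
          (h ▸ lam₂ : C(Torus r₁, Circle)) k = lam₁ (k + (a : Torus r₁))) →
        {V : EllTwo r₁ →L[ℂ] EllTwo r₁ |
            IsUniformIntertwiner lam₁ (h ▸ lam₂ : C(Torus r₁, Circle)) V} =
          {V : EllTwo r₁ →L[ℂ] EllTwo r₁ |
            ∃ ρ : C(Torus r₁, ℂ), V = fourierMulOp r₁ ρ ∘L expPosition r₁ a} := by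
  obtain ⟨V, hV0, hV⟩ := hV
  obtain ⟨hint, hu⟩ := (isUniformIntertwiner_iff lam₁ lam₂ V).1 hV
  have hnv : ¬ Vanishes (pullback V) Set.univ Set.univ := by
    intro hv
    refine hV0 (pullback_injective (ContinuousLinearMap.ext fun ξ => ?_))
    have h0 : pullback V ξ = 0 := inner_self_eq_zero.1 (hv ξ (pullback V ξ)
      (Filter.Eventually.of_forall fun k hk => absurd (Set.mem_univ k) hk)
      (Filter.Eventually.of_forall fun k hk => absurd (Set.mem_univ k) hk))
    rw [h0, pullback_apply]
    simp
  obtain ⟨a, b, -, -, hsh⟩ := (hint.vanishes_or_shift han₁ han₂ hper₁ hu isClosed_univ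
    isClosed_univ).resolve_left hnv
  have h : r₂ = r₁ := eq_of_shift hper₁ hper₂ hsh
  subst h
  refine ⟨rfl, ⟨((b - a : ℝ) : Torus r₂), fun k => ?_, fun α hα => ?_⟩, fun c hc => ?_⟩
  · induction k using QuotientAddGroup.induction_on with
    | H k => exact hsh k
  · -- The difference of two admissible shifts is a period of `λ₁`.
    have hp := hper₁ (α - ((b - a : ℝ) : Torus r₂)) fun k => by
      have h1 : lam₂ (k - ((b - a : ℝ) : Torus r₂)) = lam₁ k := by
        induction k using QuotientAddGroup.induction_on with
        | H k =>
          have := hsh (k - (b - a))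
          rwa [sub_add_cancel] at this
      rw [← h1, show k + (α - ((b - a : ℝ) : Torus r₂)) = k - ((b - a : ℝ) : Torus r₂) + α by abel]
      exact (hα _).symm
    exact sub_eq_zero.1 hp
  · ext V
    exact isUniformIntertwiner_iff_exists han₂ hper₂ hc V
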